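/- Throughout, $M$ is a smooth (finite-dimensional, Hausdorff, $\sigma$-compact, boundaryless) manifold, $E\to M$ a smooth real vector bundle of finite rank, and all bundles and bundle maps are smooth. Let $\mathfrak D E$ be the bundle of covariant differential operators of $E$: its fibre at $x$ consists of the linear maps $\delta:\Gamma(E)\to E_x$, with a symbol $\mathbb j(\delta)\in T_xM$, such that $\delta(fu)=f(x)\delta(u)+(\mathbb j(\delta)f)\,u(x)$; the bracket $[\cdot,\cdot]_{\mathfrak D}$ on $\Gamma(\mathfrak D E)$ is the commutator. The jet bundle is regarded as $\mathfrak J E=\{\nu\in\mathrm{Hom}(\mathfrak D E,E)\mid \nu(\Phi)=\Phi(\nu(\mathbf 1_E))\ \forall\,\Phi\in\mathfrak{gl}(E)\}$, and $\mathbb d u\in\Gamma(\mathfrak J E)$ is given by $\mathbb d u(\delta)=\delta(u)$ for $u\in\Gamma(E)$. **$E$-Courant algebroids.** An $E$-Courant algebroid is a vector bundle $\mathcal K\to M$ with a symmetric, fibrewise nondegenerate pairing $(\cdot,\cdot)_E:\mathcal K\otimes\mathcal K\to E$, a bundle map $\rho:\mathcal K\to\mathfrak D E$, and an $\mathbb R$-bilinear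 bracket $[\cdot,\cdot]$ on $\Gamma(\mathcal K)$ with $[X,[Y,Z]]=[[X,Y],Z]+[Y,[X,Z]]$, such that for all $X,Y,Z\in\Gamma(\mathcal K)$: (EC-1) $\rho[X,Y]=[\rho(X),\rho(Y)]_{\mathfrak D}$; (EC-2) $[X,X]=\rho^\star\mathbb d(X,X)_E$; (EC-3) $\rho(X)(Y,Z)_E=([X,Y],Z)_E+(Y,[X,Z])_E$; (EC-4) $\rho^\star(\mathfrak J E)\subset\mathcal K$, that is, for every $\mu\in\mathfrak J E$ there is a (necessarily unique) $\rho^\star(\mu)\in\mathcal K$ with $(\rho^\star(\mu),k)_E=\tfrac12\mu(\rho(k))$ for all $k\in\mathcal K$; (EC-5) $\rho\circ\rho^\star=0$. A Dirac structure is a subbundle $L\subset\mathcal K$ with $L=L^\perp$ and $[\Gamma(L),\Gamma(L)]\subset\Gamma(L)$. **$E$-dual pairs.** Let $A,B$ be vector bundles with a pairing $\langle\cdot,\cdot\rangle_E:A\times_M B\to E$ that is nondegenerate in both arguments, so that $B\subset\mathrm{Hom}(A,E)$ and $A\subset\mathrm{Hom}(B,E)$. Let $A$ be a Lie algebroid with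 a representation $\rho_A:A\to\mathfrak D E$ on $E$, and let $\mathrm d^A$ be the associated coboundary operator on $\Omega^\bullet(A,E)=\Gamma(\mathrm{Hom}(\wedge^\bullet A,E))$. Put $\mathrm{Hom}(\wedge^0A,E)_B=E$ and, for $k\ge1$, $\mathrm{Hom}(\wedge^kA,E)_B=\{\mu\mid \mu(X_1,\dots,X_{k-1},\cdot)\in B\ \forall\,X_i\}$. The representation $\rho_A$ is $B$-invariant if $\Gamma(\mathrm{Hom}(\wedge^\bullet A,E)_B)$ is a subcomplex of $(\Omega^\bullet(A,E),\mathrm d^A)$. Then $\mathrm d^Au\in\Gamma(B)$ for $u\in\Gamma(E)$, and for $X\in\Gamma(A)$, $\xi\in\Gamma(B)$ there is $\mathfrak L_X\xi\in\Gamma(B)$ with $\langle Y,\mathfrak L_X\xi\rangle_E=\rho_A(X)\langle Y,\xi\rangle_E-\langle[X,Y],\xi\rangle_E$ for all $Y\in\Gamma(A)$. For $\Xi\in\Gamma(\mathrm{Hom}(\wedge^2B,E))$ put $(\mathfrak L_X\Xi)(\xi,\eta)=\rho_A(X)(\Xi(\xi,\eta))-\Xi(\mathfrak L_X\xi,\eta)-\Xi(\xi,\mathfrak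 L_X\eta)$, and for $X,Y\in\Gamma(A)$ put $\mathfrak L_XY=[X,Y]$. The same notions are used with $A$ and $B$ exchanged. An $E$-dual pair of Lie algebroids $((A,\rho_A);(B,\rho_B))$ consists of Lie algebroids $A,B$ with a pairing as above, a $B$-invariant representation $\rho_A$ and an $A$-invariant representation $\rho_B$ on $E$. It is an $E$-Lie bialgebroid if for all $X,Y\in\Gamma(A)$ and $u\in\Gamma(E)$: (1) $\mathrm d^B[X,Y]=\mathfrak L_X(\mathrm d^BY)-\mathfrak L_Y(\mathrm d^BX)$; (2) $\mathfrak L_{\mathrm d^Au}X=-\mathfrak L_{\mathrm d^Bu}X$; (3) $\langle\mathrm d^Bu,\mathrm d^Au\rangle_E=0$. **Theorem.** Let $\mathcal K$ be an $E$-Courant algebroid and let $A,B\subset\mathcal K$ be Dirac structures with $\mathcal K=A\oplus B$. Equip $A$ and $B$ with the restrictions of the bracket of $\mathcal K$, the anchors $\mathbb j\circ\rho|_A$ and $\mathbb j\circ\rho|_B$, the maps $\rho_A=\rho|_A$ and $\rho_B=\rho|_B$ into $\mathfrak D E$, and the pairing $\langle X,\xi\rangle_E=2(X,\xi)_E$ for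 $X\in A$, $\xi\in B$. Then $A$ and $B$ are Lie algebroids, $\rho_A$ and $\rho_B$ are representations of them on $E$, $((A,\rho_A);(B,\rho_B))$ is an $E$-dual pair of Lie algebroids, and it is an $E$-Lie bialgebroid. -/

import Mathlib

open Bundle
open scoped Manifold ContDiff

noncomputable section

section SmoothModule

/-! ### Sections as a module over the smooth functions -/

variable {EM : Type*} [NormedAddCommGroup EM] [NormedSpace ℝ EM]
  {HM : Type*} [TopologicalSpace HM] {I : ModelWithCorners ℝ EM HM}
  {M : Type*} [TopologicalSpace M] [ChartedSpace HM M]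
  {F : Type*} [NormedAddCommGroup F] [NormedSpace ℝ F]
  {V : M → Type*} [TopologicalSpace (TotalSpace F V)]
  [∀ x, AddCommGroup (V x)] [∀ x, Module ℝ (V x)] [∀ x, TopologicalSpace (V x)]
  [FiberBundle F V] [VectorBundle ℝ F V]

instance smoothSectionSMul : SMul C^∞⟮I, M; ℝ⟯ Cₛ^∞⟮I; F, V⟯ :=
  ⟨fun f s => ⟨fun x => f x • s x, f.contMDiff.smul_section s.contMDiff⟩⟩

@[simp] theorem smoothSection_smul_apply (f : C^∞⟮I, M; ℝ⟯) (s : Cₛ^∞⟮I; F, V⟯) (x : M) :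
    (f • s) x = f x • s x := rfl

/-- `Γ(V)` is a module over `C^∞(M)`. -/
instance smoothSectionModule : Module C^∞⟮I, M; ℝ⟯ Cₛ^∞⟮I; F, V⟯ where
  one_smul s := by ext x; simp
  mul_smul f g s := by ext x; simp [mul_smul]
  smul_zero f := by ext x; simp
  smul_add f s t := by ext x; simp
  add_smul f g s := by ext x; simp [add_smul]
  zero_smul s := by ext x; simp

end SmoothModule

section Definitions

variable {EM : Type*} [NormedAddCommGroup EM] [NormedSpace ℝ EM]
  {HM : Type*} [TopologicalSpace HM] (I : ModelWithCorners ℝ EM HM)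
  {M : Type*} [TopologicalSpace M] [ChartedSpace HM M] [IsManifold I ∞ M]
  (FE : Type*) [NormedAddCommGroup FE] [NormedSpace ℝ FE]
  (E : M → Type*) [TopologicalSpace (TotalSpace FE E)]
  [∀ x, AddCommGroup (E x)] [∀ x, Module ℝ (E x)] [∀ x, TopologicalSpace (E x)]
  [FiberBundle FE E] [VectorBundle ℝ FE E]
  (FK : Type*) [NormedAddCommGroup FK] [NormedSpace ℝ FK]
  (K : M → Type*) [TopologicalSpace (TotalSpace FK K)]
  [∀ x, AddCommGroup (K x)] [∀ x, Module ℝ (K x)] [∀ x, TopologicalSpace (K x)]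
  [FiberBundle FK K] [VectorBundle ℝ FK K]
  (FA : Type*) [NormedAddCommGroup FA] [NormedSpace ℝ FA]
  (A : M → Type*) [TopologicalSpace (TotalSpace FA A)]
  [∀ x, AddCommGroup (A x)] [∀ x, Module ℝ (A x)] [∀ x, TopologicalSpace (A x)]
  [FiberBundle FA A] [VectorBundle ℝ FA A]
  (FB : Type*) [NormedAddCommGroup FB] [NormedSpace ℝ FB]
  (B : M → Type*) [TopologicalSpace (TotalSpace FB B)]
  [∀ x, AddCommGroup (B x)] [∀ x, Module ℝ (B x)] [∀ x, TopologicalSpace (B x)]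
  [FiberBundle FB B] [VectorBundle ℝ FB B]

/-! ### Bundle maps -/

/-- A smooth vector bundle map `A → K` over the identity of `M`: a family of linear maps of the
fibres which sends smooth sections to smooth sections. -/
structure SmoothBundleMap where
  toFun : ∀ x, A x →ₗ[ℝ] K x
  smooth' : ∀ s : Cₛ^∞⟮I; FA, A⟯, CMDiff ∞ (T% fun x => toFun x (s x))

variable {I FK K FA A} in
/-- The induced map `Γ(A) → Γ(K)`. -/
def SmoothBundleMap.onSections (φ : SmoothBundleMap I FK K FA A) (s : Cₛ^∞⟮I; FA, A⟯) :
    Cₛ^∞⟮I; FK, K⟯ :=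
  ⟨fun x => φ.toFun x (s x), φ.smooth' s⟩

/-! ### The bundle `𝔇E` of covariant differential operators and the jet bundle `𝔍E` -/

/-- The fibre of `𝔇E` at `x`. An element is a linear map `δ : Γ(E) → E_x` together with its symbol,
a tangent vector `v` at `x`, such that `δ (f u) = f(x) δ(u) + v(f) u(x)`. (The symbol is determined
by `δ` unless `E = 0`, in which case `𝔇E = TM`.) -/
def CDO (x : M) : Submodule ℝ ((Cₛ^∞⟮I; FE, E⟯ →ₗ[ℝ] E x) × TangentSpace I x) where
  carrier := {d | ∀ (f : C^∞⟮I, M; ℝ⟯) (u : Cₛ^∞⟮I; FE, E⟯),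
    d.1 (f • u) = f x • d.1 u + (mvfderiv I f x d.2) • u x}
  add_mem' := by
    intro a b ha hb f u
    simp only [Prod.fst_add, Prod.snd_add, LinearMap.add_apply, ha f u, hb f u, map_add, add_smul,
      smul_add]
    abel
  zero_mem' := by
    intro f u
    simp
  smul_mem' := by
    intro c a ha f u
    simp only [Prod.smul_fst, Prod.smul_snd, LinearMap.smul_apply, ha f u, map_smul, smul_add,
      smul_smul, smul_eq_mul]
    rw [mul_comm]

variable {I FE E} in
/-- The value `δ(u) ∈ E_x` of `δ ∈ (𝔇E)_x` on a section `u`. -/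
def cdoApply {x : M} (d : CDO I FE E x) (u : Cₛ^∞⟮I; FE, E⟯) : E x := d.1.1 u

variable {I FE E} in
/-- The symbol map `𝕛 : 𝔇E → TM`. -/
def cdoSymbol {x : M} (d : CDO I FE E x) : TangentSpace I x := d.1.2

/-- The inclusion `𝔤𝔩(E)_x → (𝔇E)_x`. -/
def glToCDO (x : M) (Φ : E x →ₗ[ℝ] E x) : CDO I FE E x :=
  ⟨({ toFun := fun u => Φ (u x)
      map_add' := fun u v => by simp
      map_smul' := fun c u => by simp }, 0), by
    intro f u
    simp⟩

/-- The fibre of `𝔍E` at `x`, as a subspace of `Hom(𝔇E, E)_x`: the `ν` such that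
`ν(Φ) = Φ(ν(1_E))` for all `Φ ∈ 𝔤𝔩(E)_x`. -/
def JetFiber (x : M) : Submodule ℝ (CDO I FE E x →ₗ[ℝ] E x) where
  carrier := {ν | ∀ Φ : E x →ₗ[ℝ] E x,
    ν (glToCDO I FE E x Φ) = Φ (ν (glToCDO I FE E x LinearMap.id))}
  add_mem' := by
    intro a b ha hb Φ
    simp [ha Φ, hb Φ]
  zero_mem' := by
    intro Φ
    simp
  smul_mem' := by
    intro c a ha Φ
    simp [ha Φ]

/-- The jet `𝕕u ∈ 𝔍E` of a section `u` at `x`, given by `𝕕u(δ) = δ(u)`. -/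
def jetD (u : Cₛ^∞⟮I; FE, E⟯) (x : M) : JetFiber I FE E x :=
  ⟨{ toFun := fun d => cdoApply d u
     map_add' := fun _ _ => rfl
     map_smul' := fun _ _ => rfl }, fun _ => rfl⟩

/-- A smooth bundle map `ρ : K → 𝔇E`: a family of linear maps of the fibres such that, for every
smooth section `X` of `K`, the operator `ρ(X)` preserves smoothness of sections of `E` and its
symbol is a smooth vector field. -/
structure CDOMap where
  toFun : ∀ x, K x →ₗ[ℝ] CDO I FE E x
  smooth_apply : ∀ (X : Cₛ^∞⟮I; FK, K⟯) (u : Cₛ^∞⟮I; FE, E⟯),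
    CMDiff ∞ (T% fun x => cdoApply (toFun x (X x)) u)
  smooth_symbol : ∀ X : Cₛ^∞⟮I; FK, K⟯,
    CMDiff ∞ (T% fun x => (cdoSymbol (toFun x (X x)) : TangentSpace I x))

variable {I FE E FK K} in
/-- `ρ(X)u ∈ Γ(E)` for `X ∈ Γ(K)` and `u ∈ Γ(E)`. -/
def CDOMap.act (ρ : CDOMap I FE E FK K) (X : Cₛ^∞⟮I; FK, K⟯) (u : Cₛ^∞⟮I; FE, E⟯) :
    Cₛ^∞⟮I; FE, E⟯ :=
  ⟨fun x => cdoApply (ρ.toFun x (X x)) u, ρ.smooth_apply X u⟩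

/-! ### `E`-Courant algebroids and Dirac structures -/

/-- A smooth `E`-valued bilinear pairing `A ×_M B → E`. -/
structure SmoothPairing where
  toFun : ∀ x, A x →ₗ[ℝ] B x →ₗ[ℝ] E x
  smooth' : ∀ (X : Cₛ^∞⟮I; FA, A⟯) (Y : Cₛ^∞⟮I; FB, B⟯), CMDiff ∞ (T% fun x => toFun x (X x) (Y x))

variable {I FE E FA A FB B} in
/-- The pairing on sections, with values in `Γ(E)`. -/
def SmoothPairing.onSections (P : SmoothPairing I FE E FA A FB B)
    (X : Cₛ^∞⟮I; FA, A⟯) (Y : Cₛ^∞⟮I; FB, B⟯) : Cₛ^∞⟮I; FE, E⟯ :=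
  ⟨fun x => P.toFun x (X x) (Y x), P.smooth' X Y⟩

variable {I FE E FA A FB B} in
/-- The pairing with its two arguments exchanged. -/
def SmoothPairing.flip (P : SmoothPairing I FE E FA A FB B) : SmoothPairing I FE E FB B FA A where
  toFun x := (P.toFun x).flip
  smooth' Y X := P.smooth' X Y

/-- An `E`-Courant algebroid structure on the vector bundle `K`. -/
structure ECourantAlgebroid where
  /-- the pairing `( , )_E` -/
  pairing : SmoothPairing I FE E FK K FK K
  pairing_symm : ∀ x k l, pairing.toFun x k l = pairing.toFun x l k
  pairing_nondegenerate : ∀ x k, (∀ l, pairing.toFun x k l = 0) → k = 0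
  /-- the bracket on `Γ(K)`, which makes it a Leibniz algebra -/
  bracket : Cₛ^∞⟮I; FK, K⟯ →ₗ[ℝ] Cₛ^∞⟮I; FK, K⟯ →ₗ[ℝ] Cₛ^∞⟮I; FK, K⟯
  leibniz : ∀ X Y Z, bracket X (bracket Y Z) = bracket (bracket X Y) Z + bracket Y (bracket X Z)
  /-- the anchor `ρ : K → 𝔇E` -/
  anchor : CDOMap I FE E FK K
  /-- `ρ[X, Y] = [ρ(X), ρ(Y)]_𝔇`, the commutator of operators on `Γ(E)` -/
  anchor_bracket : ∀ X Y u, anchor.act (bracket X Y) u =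
    anchor.act X (anchor.act Y u) - anchor.act Y (anchor.act X u)
  /-- the map `ρ^⋆` on `𝔍E`, taking values in `K`; it is determined by `pairing_rhoStar` -/
  rhoStar : ∀ x, JetFiber I FE E x →ₗ[ℝ] K x
  /-- `(ρ^⋆(μ), k)_E = ½ μ(ρ(k))` -/
  pairing_rhoStar : ∀ x (μ : JetFiber I FE E x) (k : K x),
    pairing.toFun x (rhoStar x μ) k = (1 / 2 : ℝ) • μ.1 (anchor.toFun x k)
  /-- `[X, X] = ρ^⋆ 𝕕 (X, X)_E` -/
  bracket_self : ∀ X x, bracket X X x = rhoStar x (jetD I FE E (pairing.onSections X X) x)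
  /-- `ρ(X)(Y, Z)_E = ([X, Y], Z)_E + (Y, [X, Z])_E` -/
  anchor_pairing : ∀ X Y Z, anchor.act X (pairing.onSections Y Z) =
    pairing.onSections (bracket X Y) Z + pairing.onSections Y (bracket X Z)
  /-- `ρ ∘ ρ^⋆ = 0` -/
  anchor_rhoStar : ∀ x (μ : JetFiber I FE E x), anchor.toFun x (rhoStar x μ) = 0

variable {I FE E FK K FA A} in
/-- A Dirac structure, given as a vector bundle `A` with an injective bundle map `ι : A → K`: the
image `L` of `ι` satisfies `L = L^⊥`, and `Γ(L)` is closed under the bracket. -/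
structure ECourantAlgebroid.IsDirac (C : ECourantAlgebroid I FE E FK K)
    (ι : SmoothBundleMap I FK K FA A) : Prop where
  injective : ∀ x, Function.Injective (ι.toFun x)
  closed : ∀ X Y : Cₛ^∞⟮I; FA, A⟯, ∃ Z : Cₛ^∞⟮I; FA, A⟯,
    ι.onSections Z = C.bracket (ι.onSections X) (ι.onSections Y)
  eq_orthogonal : ∀ x (k : K x),
    k ∈ LinearMap.range (ι.toFun x) ↔
      ∀ l ∈ LinearMap.range (ι.toFun x), C.pairing.toFun x k l = 0

/-! ### Lie algebroids, representations, and the complex `Ω^•(A, E)` -/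

/-- A Lie algebroid structure on the vector bundle `A`. -/
structure LieAlgebroid where
  bracket : Cₛ^∞⟮I; FA, A⟯ →ₗ[ℝ] Cₛ^∞⟮I; FA, A⟯ →ₗ[ℝ] Cₛ^∞⟮I; FA, A⟯
  bracket_self : ∀ X, bracket X X = 0
  jacobi : ∀ X Y Z, bracket X (bracket Y Z) = bracket (bracket X Y) Z + bracket Y (bracket X Z)
  /-- the anchor `a : A → TM` -/
  anchor : SmoothBundleMap I EM (TangentSpace I : M → Type _) FA A
  /-- `[X, fY] = f [X, Y] + (a(X) f) Y` -/
  leibniz : ∀ (X Y : Cₛ^∞⟮I; FA, A⟯) (f : C^∞⟮I, M; ℝ⟯) (x : M),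
    bracket X (f • Y) x = f x • bracket X Y x + (mvfderiv I f x (anchor.toFun x (X x))) • Y x
  /-- `a([X, Y]) f = a(X) (a(Y) f) - a(Y) (a(X) f)` -/
  anchor_bracket : ∀ (X Y : Cₛ^∞⟮I; FA, A⟯) (f : C^∞⟮I, M; ℝ⟯) (x : M),
    mvfderiv I f x (anchor.toFun x (bracket X Y x)) =
      mvfderiv I (fun y => mvfderiv I f y (anchor.toFun y (Y y))) x (anchor.toFun x (X x)) -
      mvfderiv I (fun y => mvfderiv I f y (anchor.toFun y (X y))) x (anchor.toFun x (Y x))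

variable {I FA A} in
/-- A representation `ρ_A : A → 𝔇E` of a Lie algebroid on `E`, i.e. a morphism of Lie algebroids
from `A` to `𝔇E`. -/
structure LieAlgebroid.Representation (L : LieAlgebroid I FA A) extends CDOMap I FE E FA A where
  symbol_eq : ∀ x (a : A x), cdoSymbol (toFun x a) = L.anchor.toFun x a
  act_bracket : ∀ X Y u, toCDOMap.act (L.bracket X Y) u =
    toCDOMap.act X (toCDOMap.act Y u) - toCDOMap.act Y (toCDOMap.act X u)

/-- `Ω^k(A, E) = Γ(Hom(∧^k A, E))`: the alternating `C^∞(M)`-multilinear maps `Γ(A)^k → Γ(E)`. -/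
abbrev EForm (k : ℕ) : Type _ :=
  Cₛ^∞⟮I; FA, A⟯ [⋀^Fin k]→ₗ[C^∞⟮I, M; ℝ⟯] Cₛ^∞⟮I; FE, E⟯

variable {I FE E FA A} in
/-- The coboundary `d^A θ ∈ Ω^{k+1}(A, E)` of `θ ∈ Ω^k(A, E)`, as a function of `k + 1` sections of
`A`:
`(d^A θ)(X_0, …, X_k) = ∑_i (-1)^i ρ_A(X_i) (θ(X_0, …, X̂_i, …, X_k))
  - ∑_{i < j} (-1)^i θ(X_0, …, X̂_i, …, X_{j-1}, [X_i, X_j], X_{j+1}, …, X_k)`.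
Moving `[X_i, X_j]` to the front turns the sign of the second sum into the usual `(-1)^{i+j}`. -/
def LieAlgebroid.Representation.coboundary {L : LieAlgebroid I FA A} (ρ : L.Representation FE E)
    {k : ℕ} (θ : EForm I FE E FA A k) (X : Fin (k + 1) → Cₛ^∞⟮I; FA, A⟯) : Cₛ^∞⟮I; FE, E⟯ :=
  ∑ i : Fin (k + 1), (-1 : ℝ) ^ (i : ℕ) • ρ.act (X i) (θ (i.removeNth X)) -
    ∑ i : Fin (k + 1), ∑ j ∈ Finset.Ioi i,
      (-1 : ℝ) ^ (i : ℕ) • θ (i.removeNth (Function.update X j (L.bracket (X i) (X j))))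

/-! ### `E`-dual pairs -/

/-- An `E`-dual pair of vector bundles `(A, B)`: an `E`-valued pairing `⟨ , ⟩_E : A ×_M B → E` which
is nondegenerate in both arguments. In particular `b ↦ ⟨·, b⟩_E` embeds `B` in `Hom(A, E)`. -/
structure EDualBundles extends SmoothPairing I FE E FA A FB B where
  nondegenerate_left : ∀ x (a : A x), (∀ b, toFun x a b = 0) → a = 0
  nondegenerate_right : ∀ x (b : B x), (∀ a, toFun x a b = 0) → b = 0

variable {I FE E FA A FB B} in
/-- `(B, A)` is an `E`-dual pair if `(A, B)` is. -/
def EDualBundles.flip (P : EDualBundles I FE E FA A FB B) : EDualBundles I FE E FB B FA A where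
  toSmoothPairing := P.toSmoothPairing.flip
  nondegenerate_left := P.nondegenerate_right
  nondegenerate_right := P.nondegenerate_left

variable {I FE E FA A FB B} in
/-- Membership in `Γ(Hom(∧^k A, E)_B)` of a `k`-form `μ`, regarded as a function of `k` sections of
`A`. There is no condition for `k = 0`; for `k ≥ 1` it says that `μ(X_1, …, X_{k-1}, ·)` belongs to
`Γ(B) ⊆ Γ(Hom(A, E))` for all `X_1, …, X_{k-1}`. -/
def EDualBundles.IsValuedIn (P : EDualBundles I FE E FA A FB B) :
    ∀ {k : ℕ}, ((Fin k → Cₛ^∞⟮I; FA, A⟯) → Cₛ^∞⟮I; FE, E⟯) → Prop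
  | 0, _ => True
  | k + 1, μ => ∀ X : Fin k → Cₛ^∞⟮I; FA, A⟯, ∃ ξ : Cₛ^∞⟮I; FB, B⟯, ∀ Y : Cₛ^∞⟮I; FA, A⟯,
      μ (Fin.snoc (α := fun _ => Cₛ^∞⟮I; FA, A⟯) X Y) = P.onSections Y ξ

variable {I FE E FA A FB B} in
/-- The representation `ρ_A` is `B`-invariant: `Γ(Hom(∧^• A, E)_B)` is a subcomplex of
`(Ω^•(A, E), d^A)`. -/
def LieAlgebroid.Representation.IsInvariant {L : LieAlgebroid I FA A} (ρ : L.Representation FE E)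
    (P : EDualBundles I FE E FA A FB B) : Prop :=
  ∀ (k : ℕ) (θ : EForm I FE E FA A k), P.IsValuedIn (fun X => θ X) →
    P.IsValuedIn (fun X => ρ.coboundary θ X)

section Invariant

variable {I FE E FA A FB B}
variable {L : LieAlgebroid I FA A} {ρ : L.Representation FE E} {P : EDualBundles I FE E FA A FB B}

theorem LieAlgebroid.Representation.IsInvariant.exists_d (h : ρ.IsInvariant P)
    (u : Cₛ^∞⟮I; FE, E⟯) :
    ∃ ξ : Cₛ^∞⟮I; FB, B⟯, ∀ X : Cₛ^∞⟮I; FA, A⟯, P.onSections X ξ = ρ.act X u := by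
  obtain ⟨ξ, hξ⟩ := h 0 (AlternatingMap.constOfIsEmpty _ _ (Fin 0) u) trivial Fin.elim0
  refine ⟨ξ, fun X => ?_⟩
  rw [← hξ X]
  simp [LieAlgebroid.Representation.coboundary, Fin.snoc]

/-- `ξ ∈ Γ(B)` as an element of `Ω^1(A, E)`. -/
def EDualBundles.toForm (P : EDualBundles I FE E FA A FB B) (ξ : Cₛ^∞⟮I; FB, B⟯) :
    EForm I FE E FA A 1 :=
  AlternatingMap.ofSubsingleton C^∞⟮I, M; ℝ⟯ _ _ (0 : Fin 1)
    { toFun := fun X => P.onSections X ξ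
      map_add' := fun X Y => by ext x; simp [SmoothPairing.onSections]
      map_smul' := fun f X => by ext x; simp [SmoothPairing.onSections] }

theorem LieAlgebroid.Representation.IsInvariant.exists_lieDeriv (h : ρ.IsInvariant P)
    (X : Cₛ^∞⟮I; FA, A⟯) (ξ : Cₛ^∞⟮I; FB, B⟯) :
    ∃ ζ : Cₛ^∞⟮I; FB, B⟯, ∀ Y : Cₛ^∞⟮I; FA, A⟯,
      P.onSections Y ζ = ρ.act X (P.onSections Y ξ) - P.onSections (L.bracket X Y) ξ := by
  obtain ⟨ζ, hζ⟩ := h 1 (P.toForm ξ) (fun _ => ⟨ξ, fun Y => by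
    simp [EDualBundles.toForm, Fin.snoc]⟩) (fun _ => X)
  obtain ⟨η, hη⟩ := h.exists_d (P.onSections X ξ)
  refine ⟨ζ + η, fun Y => ?_⟩
  have hadd : P.onSections Y (ζ + η) = P.onSections Y ζ + P.onSections Y η := by
    ext x; simp [SmoothPairing.onSections]
  rw [hadd, ← hζ Y, hη Y]
  have h0 : Finset.Ioi (0 : Fin 2) = {1} := by decide
  have h1 : Finset.Ioi (1 : Fin 2) = ∅ := by decide
  simp [LieAlgebroid.Representation.coboundary, Fin.snoc, h0, h1, EDualBundles.toForm,
    Fin.sum_univ_two, Fin.removeNth]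
  abel

/-- `d^A u ∈ Γ(B)` for `u ∈ Γ(E)`, characterised by `⟨X, d^A u⟩_E = ρ_A(X) u`. -/
def LieAlgebroid.Representation.IsInvariant.d (h : ρ.IsInvariant P) (u : Cₛ^∞⟮I; FE, E⟯) :
    Cₛ^∞⟮I; FB, B⟯ :=
  (h.exists_d u).choose

theorem LieAlgebroid.Representation.IsInvariant.onSections_d (h : ρ.IsInvariant P)
    (u : Cₛ^∞⟮I; FE, E⟯) (X : Cₛ^∞⟮I; FA, A⟯) : P.onSections X (h.d u) = ρ.act X u :=
  (h.exists_d u).choose_spec X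

/-- The Lie derivative `𝔏_X ξ ∈ Γ(B)` of `ξ ∈ Γ(B)` along `X ∈ Γ(A)`, characterised by
`⟨Y, 𝔏_X ξ⟩_E = ρ_A(X) ⟨Y, ξ⟩_E - ⟨[X, Y], ξ⟩_E`. -/
def LieAlgebroid.Representation.IsInvariant.lieDeriv (h : ρ.IsInvariant P)
    (X : Cₛ^∞⟮I; FA, A⟯) (ξ : Cₛ^∞⟮I; FB, B⟯) : Cₛ^∞⟮I; FB, B⟯ :=
  (h.exists_lieDeriv X ξ).choose

theorem LieAlgebroid.Representation.IsInvariant.onSections_lieDeriv (h : ρ.IsInvariant P)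
    (X : Cₛ^∞⟮I; FA, A⟯) (ξ : Cₛ^∞⟮I; FB, B⟯) (Y : Cₛ^∞⟮I; FA, A⟯) :
    P.onSections Y (h.lieDeriv X ξ) =
      ρ.act X (P.onSections Y ξ) - P.onSections (L.bracket X Y) ξ :=
  (h.exists_lieDeriv X ξ).choose_spec Y

/-- The Lie derivative along `X ∈ Γ(A)` of a function `Ξ` of two sections of `B` (an element of
`Γ(Hom(∧^2 B, E)_A)`):
`(𝔏_X Ξ)(ξ, η) = ρ_A(X) (Ξ(ξ, η)) - Ξ(𝔏_X ξ, η) - Ξ(ξ, 𝔏_X η)`. -/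
def LieAlgebroid.Representation.IsInvariant.lieDeriv₂ (h : ρ.IsInvariant P)
    (X : Cₛ^∞⟮I; FA, A⟯) (Ξ : (Fin 2 → Cₛ^∞⟮I; FB, B⟯) → Cₛ^∞⟮I; FE, E⟯)
    (ξ : Fin 2 → Cₛ^∞⟮I; FB, B⟯) : Cₛ^∞⟮I; FE, E⟯ :=
  ρ.act X (Ξ ξ) - Ξ ![h.lieDeriv X (ξ 0), ξ 1] - Ξ ![ξ 0, h.lieDeriv X (ξ 1)]

end Invariant

/-- An `E`-dual pair of Lie algebroids `((A, ρ_A); (B, ρ_B))`. -/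
structure EDualPair where
  /-- the pairing `⟨ , ⟩_E` between `A` and `B` -/
  dual : EDualBundles I FE E FA A FB B
  lieA : LieAlgebroid I FA A
  lieB : LieAlgebroid I FB B
  repA : lieA.Representation FE E
  repB : lieB.Representation FE E
  invA : repA.IsInvariant dual
  invB : repB.IsInvariant dual.flip

variable {I FE E FA A FB B} in
/-- The `2`-form `d^B X ∈ Γ(Hom(∧^2 B, E)_A)` of a section `X` of `A ⊆ Hom(B, E)`. -/
def EDualPair.dB (D : EDualPair I FE E FA A FB B) (X : Cₛ^∞⟮I; FA, A⟯) :
    (Fin 2 → Cₛ^∞⟮I; FB, B⟯) → Cₛ^∞⟮I; FE, E⟯ :=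
  D.repB.coboundary (D.dual.flip.toForm X)

variable {I FE E FA A FB B} in
/-- An `E`-dual pair of Lie algebroids is an `E`-Lie bialgebroid if
1. `d^B [X, Y] = 𝔏_X (d^B Y) - 𝔏_Y (d^B X)`,
2. `𝔏_{d^A u} X = -𝔏_{d^B u} X`, where `𝔏_{d^B u} X = [d^B u, X]`,
3. `⟨d^B u, d^A u⟩_E = 0`,
for all `X, Y ∈ Γ(A)` and `u ∈ Γ(E)`. -/
structure EDualPair.IsELieBialgebroid (D : EDualPair I FE E FA A FB B) : Prop where
  dB_bracket : ∀ (X Y : Cₛ^∞⟮I; FA, A⟯) (ξ : Fin 2 → Cₛ^∞⟮I; FB, B⟯),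
    D.dB (D.lieA.bracket X Y) ξ = D.invA.lieDeriv₂ X (D.dB Y) ξ - D.invA.lieDeriv₂ Y (D.dB X) ξ
  lieDeriv_d : ∀ (u : Cₛ^∞⟮I; FE, E⟯) (X : Cₛ^∞⟮I; FA, A⟯),
    D.invB.lieDeriv (D.invA.d u) X = -D.lieA.bracket (D.invB.d u) X
  pairing_d : ∀ u : Cₛ^∞⟮I; FE, E⟯, D.dual.onSections (D.invB.d u) (D.invA.d u) = 0

end Definitions

end

/-! Write `Du` for `ρ^⋆ 𝕕u` (`C.diff u`), so that `2 (Du, Y)_E = ρ(Y)u`. Testing against arbitrary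
sections, nondegeneracy turns the axioms into a calculus: `[X, Y] + [Y, X] = 2 D(X, Y)_E`, `[X, Du]
= D(ρ(X)u)`, hence `[Du, X] = 0`, together with `ρ(Du) = 0` and the Leibniz rule for `[X, fY]`. The
symmetric part of the bracket is `D` of the pairing, which vanishes on an isotropic subbundle; so a
Dirac structure is a Lie algebroid, and `ρ` represents it on `E`.

Because `A` and `B` are complementary and each is its own orthogonal, the pairing between them is
nondegenerate, and the `B`-component of a section `Z` of `K` is the section of `B` that represents
`2 (·, Z)_E` on `Γ(A)`. Hence `Du = d^B u + d^A u`, and `𝔏_X ξ` is the `B`-component of `[X, ξ]`.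
Invariance in all degrees reduces to the existence of these two kinds of sections
(`isInvariant_of_exists`).

The bialgebroid conditions are then read off in `K`. Condition (3) is `(Du, Du)_E = ½ ρ(Du)u = 0`.
Condition (2) is the `A`-component of `[Du, X] = 0`. Condition (1) is the Leibniz identity for `X,
Y, ξ` paired with `η`, by `d^B X(ξ, η) = -2 ([X, ξ], η)_E` (`dB_eq`).

Both `ρ^⋆` and the splitting of `K` are given only fibrewise; the smoothness of what they produce
comes from `SmoothPairing.contMDiff_of_forall`. -/

noncomputable section

set_option linter.unusedSectionVars false

/-! ### Smoothness of sections detected by a nondegenerate pairing -/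

section SmoothSections

open Filter Topology Module

variable {EM : Type*} [NormedAddCommGroup EM] [NormedSpace ℝ EM]
  {HM : Type*} [TopologicalSpace HM] {I : ModelWithCorners ℝ EM HM}
  {M : Type*} [TopologicalSpace M] [ChartedSpace HM M]

/-- A function `c` that solves a linear equation `N c = g` with smooth data is smooth near a point
where `N` is injective. -/
theorem contMDiffAt_of_clm_apply_eq {U G : Type*}
    [NormedAddCommGroup U] [NormedSpace ℝ U] [FiniteDimensional ℝ U]
    [NormedAddCommGroup G] [NormedSpace ℝ G] [FiniteDimensional ℝ G]
    {N : M → U →L[ℝ] G} {g : M → G} {c : M → U} {x₀ : M}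
    (hN : CMDiffAt ∞ N x₀) (hg : CMDiffAt ∞ g x₀) (hinj : Function.Injective (N x₀))
    (hc : ∀ᶠ y in 𝓝 x₀, N y (c y) = g y) : CMDiffAt ∞ c x₀ := by
  have : CompleteSpace U := FiniteDimensional.complete ℝ U
  -- For a left inverse `R` of `N x₀`, the endomorphism `R ∘ N y` is the identity at `x₀`, hence
  -- invertible nearby, where `c = (R ∘ N)⁻¹ (R g)`.
  obtain ⟨R, hR⟩ := (N x₀ : U →ₗ[ℝ] G).exists_leftInverse_of_injective
    (LinearMap.ker_eq_bot.2 hinj)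
  let R' : G →L[ℝ] U := R.toContinuousLinearMap
  have hR' : R' ∘L N x₀ = 1 := by
    ext v
    exact LinearMap.congr_fun hR v
  have hT : CMDiffAt ∞ (fun y => R' ∘L N y) x₀ := contMDiffAt_const.clm_comp hN
  have hinv : CMDiffAt ∞ (fun y => Ring.inverse (R' ∘L N y)) x₀ := by
    have h1 : ContDiffAt ℝ ∞ Ring.inverse (R' ∘L N x₀) := by
      rw [hR']
      exact contDiffAt_ringInverse ℝ (1 : (U →L[ℝ] U)ˣ)
    exact h1.contMDiffAt.comp x₀ hT
  have hunit : ∀ᶠ y in 𝓝 x₀, IsUnit (R' ∘L N y) := by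
    refine hT.continuousAt.eventually (p := fun T => IsUnit T) ?_
    show _ ∈ 𝓝 (R' ∘L N x₀)
    rw [hR']
    exact Units.isOpen.mem_nhds isUnit_one
  have hRg : CMDiffAt ∞ (fun y => R' (g y)) x₀ := contMDiffAt_const.clm_apply hg
  refine (hinv.clm_apply hRg).congr_of_eventuallyEq ?_
  filter_upwards [hunit, hc] with y hy hcy
  rw [← hcy]
  have := Ring.inverse_mul_cancel _ hy
  exact (DFunLike.congr_fun this (c y)).symm

variable {F : Type*} [NormedAddCommGroup F] [NormedSpace ℝ F]
  {V : M → Type*} [TopologicalSpace (TotalSpace F V)]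
  [∀ x, AddCommGroup (V x)] [∀ x, Module ℝ (V x)] [∀ x, TopologicalSpace (V x)]
  [FiberBundle F V] [VectorBundle ℝ F V]

/-- Multiplication by a bump function that is `1` near `x₀` and has its support inside `u`. This is
needed because pairings and brackets take global sections only. -/
theorem exists_smoothSection_eventuallyEq [FiniteDimensional ℝ EM] [T2Space M] [IsManifold I ∞ M]
    {s : ∀ x, V x} {u : Set M} {x₀ : M}
    (hu : u ∈ 𝓝 x₀) (hs : CMDiff[u] ∞ (T% s)) :
    ∃ σ : Cₛ^∞⟮I; F, V⟯, ∀ᶠ y in 𝓝 x₀, σ y = s y := by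
  obtain ⟨f, -, hf⟩ := (SmoothBumpFunction.nhds_basis_tsupport (I := I) x₀).mem_iff.1
    (interior_mem_nhds.2 hu)
  refine ⟨⟨fun x => f x • s x, ?_⟩, ?_⟩
  · exact ContMDiffOn.smul_section_of_tsupport f.contMDiff.contMDiffOn isOpen_interior hf
      (hs.mono interior_subset)
  · filter_upwards [f.eventuallyEq_one] with y hy
    show f y • s y = s y
    rw [hy]
    simp

theorem exists_smoothSection_apply_eq [FiniteDimensional ℝ EM] [T2Space M] [IsManifold I ∞ M]
    [ContMDiffVectorBundle ∞ F V I] (x₀ : M) (v : V x₀) :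
    ∃ σ : Cₛ^∞⟮I; F, V⟯, σ x₀ = v := by
  obtain ⟨u, hu, hs⟩ := FiberBundle.exists_contMDiffOn_extend (k := ∞) I F v
  obtain ⟨σ, hσ⟩ := exists_smoothSection_eventuallyEq hu hs
  exact ⟨σ, by rw [hσ.self_of_nhds]; simp⟩

theorem contMDiff_mvfderiv_apply [IsManifold I ∞ M] (f : C^∞⟮I, M; ℝ⟯)
    {Z : ∀ x : M, TangentSpace I x} (hZ : CMDiff ∞ (T% Z)) :
    CMDiff ∞ (fun x => mvfderiv I f x (Z x)) := by
  have h1 : CMDiff ∞ (tangentMap% f) := f.contMDiff.contMDiff_tangentMap (by simp)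
  exact (contMDiff_snd_tangentBundle_modelSpace ℝ 𝓘(ℝ, ℝ)).comp (h1.comp hZ)

variable [FiniteDimensional ℝ EM] [T2Space M] [IsManifold I ∞ M]
  [FiniteDimensional ℝ F] [ContMDiffVectorBundle ∞ F V I]
  {FE : Type*} [NormedAddCommGroup FE] [NormedSpace ℝ FE] [FiniteDimensional ℝ FE]
  {E : M → Type*} [TopologicalSpace (TotalSpace FE E)]
  [∀ x, AddCommGroup (E x)] [∀ x, Module ℝ (E x)] [∀ x, TopologicalSpace (E x)]
  [FiberBundle FE E] [VectorBundle ℝ FE E] [ContMDiffVectorBundle ∞ FE E I]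
  {FW : Type*} [NormedAddCommGroup FW] [NormedSpace ℝ FW] [FiniteDimensional ℝ FW]
  {W : M → Type*} [TopologicalSpace (TotalSpace FW W)]
  [∀ x, AddCommGroup (W x)] [∀ x, Module ℝ (W x)] [∀ x, TopologicalSpace (W x)]
  [FiberBundle FW W] [VectorBundle ℝ FW W] [ContMDiffVectorBundle ∞ FW W I]

/-- If a pairing `V ×_M W → E` is nondegenerate in its first argument, then a section of `V` is
smooth as soon as its pairing with every smooth section of `W` is smooth. -/
theorem SmoothPairing.contMDiff_of_forall (P : SmoothPairing I FE E F V FW W)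
    (hP : ∀ x v, (∀ w, P.toFun x v w = 0) → v = 0) {s : ∀ x, V x}
    (hs : ∀ Y : Cₛ^∞⟮I; FW, W⟯, CMDiff ∞ (T% fun x => P.toFun x (s x) (Y x))) :
    CMDiff ∞ (T% s) := by
  intro x₀
  have : ContMDiffVectorBundle 1 F V I := ContMDiffVectorBundle.of_le (n := ∞) (by simp)
  have : FiniteDimensional ℝ (W x₀) := VectorBundle.finiteDimensional ℝ FW W x₀
  let t := trivializationAt F V x₀
  have ht : x₀ ∈ t.baseSet := FiberBundle.mem_baseSet_trivializationAt F V x₀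
  let b := Module.finBasis ℝ F
  have hfr := t.isLocalFrameOn_localFrame_baseSet I ∞ b
  let e := trivializationAt FE E x₀
  have he : x₀ ∈ e.baseSet := FiberBundle.mem_baseSet_trivializationAt FE E x₀
  -- The `v i` are global sections that agree with a local frame of `V` near `x₀`. The `w j` below
  -- need only form a basis at `x₀` itself.
  choose v hv using fun i => exists_smoothSection_eventuallyEq (t.open_baseSet.mem_nhds ht)
    (hfr.contMDiffOn i)
  let bW := Module.finBasis ℝ (W x₀)
  choose w hw using fun j => exists_smoothSection_apply_eq (I := I) (F := FW) x₀ (bW j)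
  let n := fun i y (j : Fin (finrank ℝ (W x₀))) => (e ⟨y, P.toFun y (v i y) (w j y)⟩).2
  have hn : ∀ i, ContMDiffAt I 𝓘(ℝ, Fin (finrank ℝ (W x₀)) → FE) ∞ (n i) x₀ := fun i => contMDiffAt_pi_space.2 fun j =>
    (e.contMDiffAt_section_iff he).1 (P.smooth' (v i) (w j) x₀)
  -- `N y` sends coefficients `c` to the pairings of `∑ c i • v i` with all `w j`, read in a
  -- trivialization of `E`. It need not be square, so injectivity at `x₀` is all that can be used.
  let N := fun y => ∑ i, ContinuousLinearMap.smulRightL ℝ (Fin (finrank ℝ F) → ℝ) _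
    (ContinuousLinearMap.proj i) (n i y)
  have hN : CMDiffAt ∞ N x₀ := by
    refine contMDiffAt_finsetSum fun i _ => ?_
    exact contMDiffAt_const.clm_apply (hn i)
  have hNy : ∀ y ∈ e.baseSet, ∀ c j,
      N y c j = (e ⟨y, P.toFun y (∑ i, c i • v i y) (w j y)⟩).2 := by
    intro y hy c j
    have : ∀ z : E y, (e ⟨y, z⟩).2 = e.continuousLinearEquivAt ℝ y hy z := fun z => rfl
    simp only [this, map_sum, LinearMap.sum_apply, map_smul, LinearMap.smul_apply]
    simp only [N, n, this, _root_.sum_apply, Finset.sum_apply]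
    rfl
  let c := fun y (i : Fin (finrank ℝ F)) => t.localFrameCoeff I b i y (s y)
  have hsc : ∀ᶠ y in 𝓝 x₀, s y = ∑ i, c y i • v i y := by
    filter_upwards [t.eventually_eq_localFrame_sum_coeff_smul (I := I) b ht (s := s),
      eventually_all.2 hv] with y hy hvy
    rw [hy]
    simp [c, hvy]
  suffices ContMDiffAt I 𝓘(ℝ, Fin (finrank ℝ F) → ℝ) ∞ c x₀ by
    rw [contMDiffAt_iff_localFrameCoeff b ht]
    exact fun i => contMDiffAt_pi_space.1 this i
  refine contMDiffAt_of_clm_apply_eq hN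
    (g := fun y j => (e ⟨y, P.toFun y (s y) (w j y)⟩).2) ?_ ?_ ?_
  · exact contMDiffAt_pi_space.2 fun j => (e.contMDiffAt_section_iff he).1 (hs (w j) x₀)
  -- Nondegeneracy at `x₀` kills the combination of the frame, and the frame is linearly
  -- independent.
  · rw [injective_iff_map_eq_zero]
    intro a ha
    have h0 : ∑ i, a i • v i x₀ = 0 := by
      refine hP x₀ _ fun z => ?_
      have : P.toFun x₀ (∑ i, a i • v i x₀) = 0 := bW.ext fun j => by
        have := congr_fun ha j
        rw [hNy x₀ he, hw] at this
        exact (e.continuousLinearEquivAt ℝ x₀ he).map_eq_zero_iff.1 this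
      rw [this, LinearMap.zero_apply]
    have hli := hfr.linearIndependent ht
    rw [Fintype.linearIndependent_iff] at hli
    ext i
    refine hli a ?_ i
    rw [← h0]
    exact Finset.sum_congr rfl fun i _ => by rw [(hv i).self_of_nhds]
  · filter_upwards [hsc, e.open_baseSet.mem_nhds he] with y hy hye
    ext j
    rw [hNy y hye, ← hy]

end SmoothSections

/-! ### Algebra of bundle maps, pairings and differential operators on sections -/

section Linearity

variable {EM : Type*} [NormedAddCommGroup EM] [NormedSpace ℝ EM]
  {HM : Type*} [TopologicalSpace HM] {I : ModelWithCorners ℝ EM HM}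
  {M : Type*} [TopologicalSpace M] [ChartedSpace HM M]
  {FE : Type*} [NormedAddCommGroup FE] [NormedSpace ℝ FE]
  {E : M → Type*} [TopologicalSpace (TotalSpace FE E)]
  [∀ x, AddCommGroup (E x)] [∀ x, Module ℝ (E x)] [∀ x, TopologicalSpace (E x)]
  [FiberBundle FE E] [VectorBundle ℝ FE E]
  {FA : Type*} [NormedAddCommGroup FA] [NormedSpace ℝ FA]
  {A : M → Type*} [TopologicalSpace (TotalSpace FA A)]
  [∀ x, AddCommGroup (A x)] [∀ x, Module ℝ (A x)] [∀ x, TopologicalSpace (A x)]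
  [FiberBundle FA A] [VectorBundle ℝ FA A]
  {FB : Type*} [NormedAddCommGroup FB] [NormedSpace ℝ FB]
  {B : M → Type*} [TopologicalSpace (TotalSpace FB B)]
  [∀ x, AddCommGroup (B x)] [∀ x, Module ℝ (B x)] [∀ x, TopologicalSpace (B x)]
  [FiberBundle FB B] [VectorBundle ℝ FB B]

namespace SmoothBundleMap

variable (φ : SmoothBundleMap I FB B FA A)

@[simp] theorem onSections_apply (X : Cₛ^∞⟮I; FA, A⟯) (x : M) :
    φ.onSections X x = φ.toFun x (X x) := rfl

theorem onSections_add (X Y : Cₛ^∞⟮I; FA, A⟯) :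
    φ.onSections (X + Y) = φ.onSections X + φ.onSections Y := by ext x; simp

theorem onSections_smul (c : ℝ) (X : Cₛ^∞⟮I; FA, A⟯) :
    φ.onSections (c • X) = c • φ.onSections X := by ext x; simp

theorem onSections_fun_smul (f : C^∞⟮I, M; ℝ⟯) (X : Cₛ^∞⟮I; FA, A⟯) :
    φ.onSections (f • X) = f • φ.onSections X := by ext x; simp

theorem onSections_zero : φ.onSections 0 = 0 := by ext x; simp

theorem onSections_injective (h : ∀ x, Function.Injective (φ.toFun x)) :
    Function.Injective φ.onSections := fun X Y hXY => by
  ext x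
  exact h x (DFunLike.congr_fun hXY x)

end SmoothBundleMap

namespace SmoothPairing

variable (P : SmoothPairing I FE E FA A FB B)

@[simp] theorem onSections_apply (X : Cₛ^∞⟮I; FA, A⟯) (Y : Cₛ^∞⟮I; FB, B⟯) (x : M) :
    P.onSections X Y x = P.toFun x (X x) (Y x) := rfl

theorem onSections_add_left (X Y : Cₛ^∞⟮I; FA, A⟯) (Z : Cₛ^∞⟮I; FB, B⟯) :
    P.onSections (X + Y) Z = P.onSections X Z + P.onSections Y Z := by ext x; simp

theorem onSections_add_right (X : Cₛ^∞⟮I; FA, A⟯) (Y Z : Cₛ^∞⟮I; FB, B⟯) :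
    P.onSections X (Y + Z) = P.onSections X Y + P.onSections X Z := by ext x; simp

theorem onSections_smul_left (c : ℝ) (X : Cₛ^∞⟮I; FA, A⟯) (Y : Cₛ^∞⟮I; FB, B⟯) :
    P.onSections (c • X) Y = c • P.onSections X Y := by ext x; simp

theorem onSections_smul_right (c : ℝ) (X : Cₛ^∞⟮I; FA, A⟯) (Y : Cₛ^∞⟮I; FB, B⟯) :
    P.onSections X (c • Y) = c • P.onSections X Y := by ext x; simp

theorem onSections_fun_smul_left (f : C^∞⟮I, M; ℝ⟯) (X : Cₛ^∞⟮I; FA, A⟯)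
    (Y : Cₛ^∞⟮I; FB, B⟯) : P.onSections (f • X) Y = f • P.onSections X Y := by ext x; simp

/-- The map sending `ξ ∈ Γ(B)` to the function `⟨·, ξ⟩` on `Γ(A)`. -/
def toFunctions : Cₛ^∞⟮I; FB, B⟯ →ₗ[ℝ] Cₛ^∞⟮I; FA, A⟯ → Cₛ^∞⟮I; FE, E⟯ where
  toFun ξ X := P.onSections X ξ
  map_add' ξ η := funext fun X => P.onSections_add_right X ξ η
  map_smul' c ξ := funext fun X => P.onSections_smul_right c X ξ

end SmoothPairing

namespace CDOMap

variable [IsManifold I ∞ M] (ρ : CDOMap I FE E FA A)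

@[simp] theorem act_apply (X : Cₛ^∞⟮I; FA, A⟯) (u : Cₛ^∞⟮I; FE, E⟯) (x : M) :
    ρ.act X u x = cdoApply (ρ.toFun x (X x)) u := rfl

theorem act_add (X : Cₛ^∞⟮I; FA, A⟯) (u v : Cₛ^∞⟮I; FE, E⟯) :
    ρ.act X (u + v) = ρ.act X u + ρ.act X v := by ext x; simp [cdoApply]

theorem act_smul (X : Cₛ^∞⟮I; FA, A⟯) (c : ℝ) (u : Cₛ^∞⟮I; FE, E⟯) :
    ρ.act X (c • u) = c • ρ.act X u := by ext x; simp [cdoApply]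

/-- The vector field `𝕛(ρ(X))` applied to a smooth function. -/
def symbolAct (X : Cₛ^∞⟮I; FA, A⟯) (f : C^∞⟮I, M; ℝ⟯) : C^∞⟮I, M; ℝ⟯ :=
  ⟨fun x => mvfderiv I f x (cdoSymbol (ρ.toFun x (X x))),
    contMDiff_mvfderiv_apply f (ρ.smooth_symbol X)⟩

theorem act_fun_smul (X : Cₛ^∞⟮I; FA, A⟯) (f : C^∞⟮I, M; ℝ⟯)
    (u : Cₛ^∞⟮I; FE, E⟯) : ρ.act X (f • u) = f • ρ.act X u + ρ.symbolAct X f • u := by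
  ext x
  exact (ρ.toFun x (X x)).2 f u

/-- The restriction of a bundle map `K → 𝔇E` along a bundle map. -/
def comp (ρ : CDOMap I FE E FB B) (φ : SmoothBundleMap I FB B FA A) : CDOMap I FE E FA A where
  toFun x := ρ.toFun x ∘ₗ φ.toFun x
  smooth_apply X u := ρ.smooth_apply (φ.onSections X) u
  smooth_symbol X := ρ.smooth_symbol (φ.onSections X)

theorem comp_act (ρ : CDOMap I FE E FB B) (φ : SmoothBundleMap I FB B FA A)
    (X : Cₛ^∞⟮I; FA, A⟯) (u : Cₛ^∞⟮I; FE, E⟯) :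
    (ρ.comp φ).act X u = ρ.act (φ.onSections X) u := rfl

end CDOMap

end Linearity

/-! ### Calculus in an `E`-Courant algebroid -/

namespace ECourantAlgebroid

variable {EM : Type*} [NormedAddCommGroup EM] [NormedSpace ℝ EM] [FiniteDimensional ℝ EM]
  {HM : Type*} [TopologicalSpace HM] {I : ModelWithCorners ℝ EM HM}
  {M : Type*} [TopologicalSpace M] [ChartedSpace HM M] [IsManifold I ∞ M] [T2Space M]
  {FE : Type*} [NormedAddCommGroup FE] [NormedSpace ℝ FE] [FiniteDimensional ℝ FE]
  {E : M → Type*} [TopologicalSpace (TotalSpace FE E)]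
  [∀ x, AddCommGroup (E x)] [∀ x, Module ℝ (E x)] [∀ x, TopologicalSpace (E x)]
  [FiberBundle FE E] [VectorBundle ℝ FE E] [ContMDiffVectorBundle ∞ FE E I]
  {FK : Type*} [NormedAddCommGroup FK] [NormedSpace ℝ FK] [FiniteDimensional ℝ FK]
  {K : M → Type*} [TopologicalSpace (TotalSpace FK K)]
  [∀ x, AddCommGroup (K x)] [∀ x, Module ℝ (K x)] [∀ x, TopologicalSpace (K x)]
  [FiberBundle FK K] [VectorBundle ℝ FK K] [ContMDiffVectorBundle ∞ FK K I]
  (C : ECourantAlgebroid I FE E FK K)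

theorem pairing_comm (X Y : Cₛ^∞⟮I; FK, K⟯) :
    C.pairing.onSections X Y = C.pairing.onSections Y X := by
  ext x
  exact C.pairing_symm x _ _

theorem eq_of_pairing_eq {X Y : Cₛ^∞⟮I; FK, K⟯}
    (h : ∀ Z, C.pairing.onSections X Z = C.pairing.onSections Y Z) : X = Y := by
  ext x
  rw [← sub_eq_zero]
  refine C.pairing_nondegenerate x _ fun l => ?_
  obtain ⟨Z, rfl⟩ := exists_smoothSection_apply_eq (I := I) (F := FK) x l
  simpa [sub_eq_zero] using DFunLike.congr_fun (h Z) x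

/-- The section `ρ^⋆ 𝕕u` of `K`. -/
def diff (u : Cₛ^∞⟮I; FE, E⟯) : Cₛ^∞⟮I; FK, K⟯ :=
  ⟨fun x => C.rhoStar x (jetD I FE E u x), C.pairing.contMDiff_of_forall C.pairing_nondegenerate
    fun Y => by
      -- Its pairing with `Y` is the smooth section `½ ρ(Y)u`.
      simp only [C.pairing_rhoStar]
      exact ((1 / 2 : ℝ) • C.anchor.act Y u).contMDiff⟩

theorem pairing_diff (u : Cₛ^∞⟮I; FE, E⟯) (Y : Cₛ^∞⟮I; FK, K⟯) :
    C.pairing.onSections (C.diff u) Y = (1 / 2 : ℝ) • C.anchor.act Y u := by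
  ext x
  exact C.pairing_rhoStar x _ _

theorem act_diff (u v : Cₛ^∞⟮I; FE, E⟯) : C.anchor.act (C.diff u) v = 0 := by
  ext x
  show cdoApply (C.anchor.toFun x (C.rhoStar x _)) v = 0
  rw [C.anchor_rhoStar]
  rfl

theorem diff_add (u v : Cₛ^∞⟮I; FE, E⟯) : C.diff (u + v) = C.diff u + C.diff v :=
  C.eq_of_pairing_eq fun Z => by
    simp only [C.pairing.onSections_add_left, pairing_diff, CDOMap.act_add, smul_add]

/-- Polarization of `[Z, Z] = D(Z, Z)_E` at `Z = X + Y`. -/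
theorem bracket_add_bracket_swap (X Y : Cₛ^∞⟮I; FK, K⟯) :
    C.bracket X Y + C.bracket Y X = (2 : ℝ) • C.diff (C.pairing.onSections X Y) := by
  have h : ∀ Z, C.bracket Z Z = C.diff (C.pairing.onSections Z Z) := fun Z => by
    ext x
    exact C.bracket_self Z x
  have hXY := h (X + Y)
  simp only [map_add, LinearMap.add_apply, C.pairing.onSections_add_left,
    C.pairing.onSections_add_right, diff_add, h X, h Y, C.pairing_comm Y X] at hXY
  linear_combination (norm := module) hXY

/-- Pairing with `Z`, (EC-3) and (EC-1) give `½ (ρ(X)ρ(Z) - ρ[X, Z])u = ½ ρ(Z)ρ(X)u`. -/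
theorem bracket_diff_right (X : Cₛ^∞⟮I; FK, K⟯) (u : Cₛ^∞⟮I; FE, E⟯) :
    C.bracket X (C.diff u) = C.diff (C.anchor.act X u) :=
  C.eq_of_pairing_eq fun Z => by
    have h := C.anchor_pairing X (C.diff u) Z
    simp only [pairing_diff, CDOMap.act_smul, C.anchor_bracket] at h ⊢
    linear_combination (norm := module) -h

/-- Since `2 (Du, X)_E = ρ(X)u`, the symmetrized bracket of `Du` and `X` is `D(ρ(X)u)`, which `[X,
Du]` already exhausts. -/
theorem bracket_diff_left (u : Cₛ^∞⟮I; FE, E⟯) (X : Cₛ^∞⟮I; FK, K⟯) :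
    C.bracket (C.diff u) X = 0 := by
  have hD : C.diff ((1 / 2 : ℝ) • C.anchor.act X u) =
      (1 / 2 : ℝ) • C.diff (C.anchor.act X u) := C.eq_of_pairing_eq fun Z => by
    simp only [pairing_diff, C.pairing.onSections_smul_left, CDOMap.act_smul]
  have h := C.bracket_add_bracket_swap (C.diff u) X
  rw [pairing_diff, hD, bracket_diff_right] at h
  linear_combination (norm := module) h

/-- Not an axiom: it follows from (EC-3) for `(fY, Z)_E` and the derivation property of `ρ(X)`. -/
theorem bracket_fun_smul (X Y : Cₛ^∞⟮I; FK, K⟯) (f : C^∞⟮I, M; ℝ⟯) :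
    C.bracket X (f • Y) = f • C.bracket X Y + C.anchor.symbolAct X f • Y :=
  C.eq_of_pairing_eq fun Z => by
    have h := C.anchor_pairing X (f • Y) Z
    rw [C.pairing.onSections_fun_smul_left, CDOMap.act_fun_smul, C.anchor_pairing X Y Z,
      C.pairing.onSections_fun_smul_left, smul_add] at h
    rw [C.pairing.onSections_add_left, C.pairing.onSections_fun_smul_left,
      C.pairing.onSections_fun_smul_left, ← sub_eq_zero]
    rw [← sub_eq_zero] at h
    rw [← neg_eq_zero, ← h]
    abel

theorem symbolAct_bracket (X Y : Cₛ^∞⟮I; FK, K⟯) (f : C^∞⟮I, M; ℝ⟯) (x : M) :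
    C.anchor.symbolAct (C.bracket X Y) f x = C.anchor.symbolAct X (C.anchor.symbolAct Y f) x -
      C.anchor.symbolAct Y (C.anchor.symbolAct X f) x := by
  rcases subsingleton_or_nontrivial (E x) with hE | hE
  -- Where `E_x = 0` operators do not determine symbols, but nondegeneracy then forces `K_x = 0`.
  · have hK : ∀ k : K x, k = 0 := fun k =>
      C.pairing_nondegenerate x k fun l => Subsingleton.elim _ _
    simp [CDOMap.symbolAct, hK, cdoSymbol]
  · obtain ⟨e, he⟩ := exists_ne (0 : E x)
    obtain ⟨u, rfl⟩ := exists_smoothSection_apply_eq (I := I) (F := FE) x e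
    refine smul_left_injective ℝ he ?_
    -- Expanding both sides on `f u`, the mixed first-order terms cancel and the coefficients of
    -- `u(x) ≠ 0` can be compared.
    have h := C.anchor_bracket X Y (f • u)
    rw [C.anchor.act_fun_smul (C.bracket X Y)] at h
    replace h := DFunLike.congr_fun h x
    simp only [CDOMap.act_fun_smul, CDOMap.act_add, C.anchor_bracket, ContMDiffSection.coe_add,
      ContMDiffSection.coe_sub, Pi.add_apply, Pi.sub_apply, smoothSection_smul_apply] at h
    show _ • u x = _ • u x
    linear_combination (norm := module) h

end ECourantAlgebroid

/-! ### Reduction of invariance to degrees zero and one -/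

section Invariance

variable {EM : Type*} [NormedAddCommGroup EM] [NormedSpace ℝ EM]
  {HM : Type*} [TopologicalSpace HM] {I : ModelWithCorners ℝ EM HM}
  {M : Type*} [TopologicalSpace M] [ChartedSpace HM M] [IsManifold I ∞ M]
  {FE : Type*} [NormedAddCommGroup FE] [NormedSpace ℝ FE]
  {E : M → Type*} [TopologicalSpace (TotalSpace FE E)]
  [∀ x, AddCommGroup (E x)] [∀ x, Module ℝ (E x)] [∀ x, TopologicalSpace (E x)]
  [FiberBundle FE E] [VectorBundle ℝ FE E]
  {FA : Type*} [NormedAddCommGroup FA] [NormedSpace ℝ FA]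
  {A : M → Type*} [TopologicalSpace (TotalSpace FA A)]
  [∀ x, AddCommGroup (A x)] [∀ x, Module ℝ (A x)] [∀ x, TopologicalSpace (A x)]
  [FiberBundle FA A] [VectorBundle ℝ FA A]
  {FB : Type*} [NormedAddCommGroup FB] [NormedSpace ℝ FB]
  {B : M → Type*} [TopologicalSpace (TotalSpace FB B)]
  [∀ x, AddCommGroup (B x)] [∀ x, Module ℝ (B x)] [∀ x, TopologicalSpace (B x)]
  [FiberBundle FB B] [VectorBundle ℝ FB B]

theorem Fin.removeNth_castSucc_snoc_eq {n : ℕ} {α : Type*} (i : Fin (n + 1)) (p : Fin (n + 1) → α)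
    (y : α) : i.castSucc.removeNth (Fin.snoc p y : Fin (n + 2) → α) =
      (Fin.snoc (i.removeNth p) y : Fin (n + 1) → α) := by
  ext j
  refine Fin.lastCases ?_ (fun j => ?_) j
  · simp [Fin.removeNth]
  · simp only [Fin.removeNth, Fin.castSucc_succAbove_castSucc, Fin.snoc_castSucc]

theorem Fin.sum_Ioi_castSucc_eq {n : ℕ} {G : Type*} [AddCommMonoid G] (i : Fin n)
    (f : Fin (n + 1) → G) :
    ∑ j ∈ Finset.Ioi i.castSucc, f j = ∑ j ∈ Finset.Ioi i, f j.castSucc + f (Fin.last n) := by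
  have h : ∀ {m : ℕ} (k : Fin m), Finset.Ioi k = Finset.univ.filter (k < ·) := fun k => by
    ext j
    simp
  rw [h, h, Finset.sum_filter, Finset.sum_filter, Fin.sum_univ_castSucc]
  simp [Fin.castSucc_lt_last]

/-- The coboundary of a form of positive degree with its last argument singled out. -/
theorem LieAlgebroid.Representation.coboundary_snoc {L : LieAlgebroid I FA A}
    (ρ : L.Representation FE E) {k : ℕ} (θ : EForm I FE E FA A (k + 1))
    (X : Fin (k + 1) → Cₛ^∞⟮I; FA, A⟯) (Y : Cₛ^∞⟮I; FA, A⟯) :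
    ρ.coboundary θ (Fin.snoc (α := fun _ => Cₛ^∞⟮I; FA, A⟯) X Y) =
      ∑ i : Fin (k + 1), (-1 : ℝ) ^ (i : ℕ) •
        (ρ.act (X i) (θ (Fin.snoc (α := fun _ => Cₛ^∞⟮I; FA, A⟯) (i.removeNth X) Y)) -
          θ (Fin.snoc (α := fun _ => Cₛ^∞⟮I; FA, A⟯) (i.removeNth X) (L.bracket (X i) Y))) +
      (-1 : ℝ) ^ (k + 1) • ρ.act Y (θ X) -
      ∑ i : Fin (k + 1), ∑ j ∈ Finset.Ioi i, (-1 : ℝ) ^ (i : ℕ) •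
        θ (Fin.snoc (α := fun _ => Cₛ^∞⟮I; FA, A⟯)
          (i.removeNth (Function.update X j (L.bracket (X i) (X j)))) Y) := by
  have hlast : Finset.Ioi (Fin.last (k + 1)) = ∅ := Finset.Ioi_eq_empty.2 isMax_top
  rw [LieAlgebroid.Representation.coboundary, Fin.sum_univ_castSucc (n := k + 1),
    Fin.sum_univ_castSucc (n := k + 1), hlast]
  -- The bracket terms with `j` last join the terms `ρ(X i)θ(…, Y)`, so that each pair has the shape
  -- of a Lie derivative.
  simp only [Fin.sum_Ioi_castSucc_eq, Fin.snoc_castSucc, Fin.snoc_last, ← Fin.snoc_update,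
    Fin.update_snoc_last, Fin.removeNth_castSucc_snoc_eq, Fin.removeNth_last, Fin.init_snoc,
    Fin.val_castSucc, Fin.val_last, Finset.sum_empty, Finset.sum_add_distrib, smul_sub,
    Finset.sum_sub_distrib]
  abel

/-- Invariance of a representation needs to be checked only for the coboundary of sections of `E`
and for Lie derivatives. -/
theorem LieAlgebroid.Representation.isInvariant_of_exists {L : LieAlgebroid I FA A}
    {ρ : L.Representation FE E} {P : EDualBundles I FE E FA A FB B}
    (hd : ∀ u, ∃ ξ, ∀ X, ρ.act X u = P.onSections X ξ)
    (hL : ∀ X ξ, ∃ ζ, ∀ Y,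
      ρ.act X (P.onSections Y ξ) - P.onSections (L.bracket X Y) ξ = P.onSections Y ζ) :
    ρ.IsInvariant P := by
  intro k θ hθ X
  rcases k with _ | k
  · obtain ⟨ξ, hξ⟩ := hd (θ ![])
    refine ⟨ξ, fun Y => ?_⟩
    rw [← hξ Y]
    simp [LieAlgebroid.Representation.coboundary, Fin.snoc]
    exact congrArg (fun X => ρ.act Y (θ X)) (Subsingleton.elim _ _)
  · choose ξ hξ using hθ
    dsimp only at hξ
    -- Being represented by a section of `B` is membership in a linear subspace, so the three sums
    -- of `coboundary_snoc` can be treated term by term: Lie derivatives of representing sections,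
    -- the differential of `θ X`, and values of `θ` itself.
    let R := LinearMap.range P.toFunctions
    suffices (fun Y => ρ.coboundary θ (Fin.snoc (α := fun _ => Cₛ^∞⟮I; FA, A⟯) X Y)) ∈ R by
      obtain ⟨ζ, hζ⟩ := this
      exact ⟨ζ, fun Y => (congr_fun hζ Y).symm⟩
    have hmem : ∀ {f : Cₛ^∞⟮I; FA, A⟯ → Cₛ^∞⟮I; FE, E⟯} (ζ : Cₛ^∞⟮I; FB, B⟯),
        (∀ Y, f Y = P.onSections Y ζ) → f ∈ R :=
      fun ζ h => ⟨ζ, funext fun Y => (h Y).symm⟩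
    simp only [LieAlgebroid.Representation.coboundary_snoc]
    refine R.sub_mem (R.add_mem ?_ ?_) ?_
    · have := R.sum_mem (t := Finset.univ) (f := fun (i : Fin (k + 1)) Y =>
        (-1 : ℝ) ^ (i : ℕ) •
        (ρ.act (X i) (θ (Fin.snoc (α := fun _ => Cₛ^∞⟮I; FA, A⟯) (i.removeNth X) Y)) -
          θ (Fin.snoc (α := fun _ => Cₛ^∞⟮I; FA, A⟯) (i.removeNth X) (L.bracket (X i) Y))))
        fun i _ => by
          refine R.smul_mem ((-1 : ℝ) ^ (i : ℕ)) (?_ : (fun Y => _) ∈ R)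
          obtain ⟨ζ, hζ⟩ := hL (X i) (ξ (i.removeNth X))
          refine hmem ζ fun Y => ?_
          rw [← hζ Y, hξ, hξ]
      convert this using 1
      ext1 Y
      simp
    · refine R.smul_mem ((-1 : ℝ) ^ (k + 1)) (?_ : (fun Y => ρ.act Y (θ X)) ∈ R)
      obtain ⟨ζ, hζ⟩ := hd (θ X)
      exact hmem ζ hζ
    · have := R.sum_mem (t := Finset.univ) (f := fun (i : Fin (k + 1)) =>
        ∑ j ∈ Finset.Ioi i, fun Y => (-1 : ℝ) ^ (i : ℕ) •
        θ (Fin.snoc (α := fun _ => Cₛ^∞⟮I; FA, A⟯)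
          (i.removeNth (Function.update X j (L.bracket (X i) (X j)))) Y))
        fun i _ => R.sum_mem fun j _ =>
          R.smul_mem ((-1 : ℝ) ^ (i : ℕ)) (hmem _ fun Y => hξ _ Y)
      convert this using 1
      ext1 Y
      simp

end Invariance

/-! ### Dirac structures as Lie algebroids -/

namespace ECourantAlgebroid

variable {EM : Type*} [NormedAddCommGroup EM] [NormedSpace ℝ EM] [FiniteDimensional ℝ EM]
  {HM : Type*} [TopologicalSpace HM] {I : ModelWithCorners ℝ EM HM}
  {M : Type*} [TopologicalSpace M] [ChartedSpace HM M] [IsManifold I ∞ M] [T2Space M]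
  {FE : Type*} [NormedAddCommGroup FE] [NormedSpace ℝ FE] [FiniteDimensional ℝ FE]
  {E : M → Type*} [TopologicalSpace (TotalSpace FE E)]
  [∀ x, AddCommGroup (E x)] [∀ x, Module ℝ (E x)] [∀ x, TopologicalSpace (E x)]
  [FiberBundle FE E] [VectorBundle ℝ FE E] [ContMDiffVectorBundle ∞ FE E I]
  {FK : Type*} [NormedAddCommGroup FK] [NormedSpace ℝ FK] [FiniteDimensional ℝ FK]
  {K : M → Type*} [TopologicalSpace (TotalSpace FK K)]
  [∀ x, AddCommGroup (K x)] [∀ x, Module ℝ (K x)] [∀ x, TopologicalSpace (K x)]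
  [FiberBundle FK K] [VectorBundle ℝ FK K] [ContMDiffVectorBundle ∞ FK K I]
  {FA : Type*} [NormedAddCommGroup FA] [NormedSpace ℝ FA] [FiniteDimensional ℝ FA]
  {A : M → Type*} [TopologicalSpace (TotalSpace FA A)]
  [∀ x, AddCommGroup (A x)] [∀ x, Module ℝ (A x)] [∀ x, TopologicalSpace (A x)]
  [FiberBundle FA A] [VectorBundle ℝ FA A] [ContMDiffVectorBundle ∞ FA A I]
  {FB : Type*} [NormedAddCommGroup FB] [NormedSpace ℝ FB] [FiniteDimensional ℝ FB]
  {B : M → Type*} [TopologicalSpace (TotalSpace FB B)]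
  [∀ x, AddCommGroup (B x)] [∀ x, Module ℝ (B x)] [∀ x, TopologicalSpace (B x)]
  [FiberBundle FB B] [VectorBundle ℝ FB B] [ContMDiffVectorBundle ∞ FB B I]
  {C : ECourantAlgebroid I FE E FK K}
  {ιA : SmoothBundleMap I FK K FA A} {ιB : SmoothBundleMap I FK K FB B}

theorem _root_.LieAlgebroid.Representation.coboundary_toForm {L : LieAlgebroid I FA A}
    (ρ : L.Representation FE E) (P : EDualBundles I FE E FA A FB B) (ξ : Cₛ^∞⟮I; FB, B⟯)
    (X : Fin 2 → Cₛ^∞⟮I; FA, A⟯) : ρ.coboundary (P.toForm ξ) X =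
      ρ.act (X 0) (P.onSections (X 1) ξ) - ρ.act (X 1) (P.onSections (X 0) ξ) -
        P.onSections (L.bracket (X 0) (X 1)) ξ := by
  have h0 : Finset.Ioi (0 : Fin 2) = {1} := by decide
  have h1 : Finset.Ioi (1 : Fin 2) = ∅ := by decide
  simp [LieAlgebroid.Representation.coboundary, h0, h1, EDualBundles.toForm,
    Fin.sum_univ_two, Fin.removeNth]
  abel

namespace IsDirac

theorem toFun_eq_zero (hA : C.IsDirac ιA) (x : M) (a b : A x) :
    C.pairing.toFun x (ιA.toFun x a) (ιA.toFun x b) = 0 :=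
  (hA.eq_orthogonal x _).1 ⟨a, rfl⟩ _ ⟨b, rfl⟩

theorem pairing_eq_zero (hA : C.IsDirac ιA) (X Y : Cₛ^∞⟮I; FA, A⟯) :
    C.pairing.onSections (ιA.onSections X) (ιA.onSections Y) = 0 := by
  ext x
  exact hA.toFun_eq_zero x _ _

theorem onSections_injective (hA : C.IsDirac ιA) : Function.Injective ιA.onSections :=
  ιA.onSections_injective hA.injective

/-- The restriction of the bracket of `K` to a Dirac structure. -/
def bracket (hA : C.IsDirac ιA) :
    Cₛ^∞⟮I; FA, A⟯ →ₗ[ℝ] Cₛ^∞⟮I; FA, A⟯ →ₗ[ℝ] Cₛ^∞⟮I; FA, A⟯ :=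
  LinearMap.mk₂ ℝ (fun X Y => (hA.closed X Y).choose)
    -- Injectivity on sections makes the chosen preimage unique, hence bilinear in its arguments.
    (fun X Y Z => hA.onSections_injective <| by
      rw [(hA.closed (X + Y) Z).choose_spec]
      simp only [ιA.onSections_add, (hA.closed _ _).choose_spec, map_add, LinearMap.add_apply])
    (fun c X Y => hA.onSections_injective <| by
      rw [(hA.closed (c • X) Y).choose_spec]
      simp only [ιA.onSections_smul, (hA.closed _ _).choose_spec, map_smul, LinearMap.smul_apply])
    (fun X Y Z => hA.onSections_injective <| by
      rw [(hA.closed X (Y + Z)).choose_spec]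
      simp only [ιA.onSections_add, (hA.closed _ _).choose_spec, map_add])
    (fun c X Y => hA.onSections_injective <| by
      rw [(hA.closed X (c • Y)).choose_spec]
      simp only [ιA.onSections_smul, (hA.closed _ _).choose_spec, map_smul])

theorem onSections_bracket (hA : C.IsDirac ιA) (X Y : Cₛ^∞⟮I; FA, A⟯) :
    ιA.onSections (hA.bracket X Y) = C.bracket (ιA.onSections X) (ιA.onSections Y) :=
  (hA.closed X Y).choose_spec

theorem bracket_self (hA : C.IsDirac ιA) (X : Cₛ^∞⟮I; FA, A⟯) : hA.bracket X X = 0 :=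
  hA.onSections_injective <| by
    have h : C.diff 0 = 0 := by
      have := C.diff_add 0 0
      rwa [add_zero, left_eq_add] at this
    have hX := C.bracket_add_bracket_swap (ιA.onSections X) (ιA.onSections X)
    rw [hA.pairing_eq_zero, h] at hX
    rw [hA.onSections_bracket, ιA.onSections_zero]
    linear_combination (norm := module) (1 / 2 : ℝ) • hX

theorem bracket_fun_smul (hA : C.IsDirac ιA) (X Y : Cₛ^∞⟮I; FA, A⟯) (f : C^∞⟮I, M; ℝ⟯) :
    hA.bracket X (f • Y) =
      f • hA.bracket X Y + C.anchor.symbolAct (ιA.onSections X) f • Y :=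
  hA.onSections_injective <| by
    simp only [hA.onSections_bracket, ιA.onSections_add, ιA.onSections_fun_smul,
      C.bracket_fun_smul]

/-- A Dirac structure is a Lie algebroid. -/
def lieAlgebroid (hA : C.IsDirac ιA) : LieAlgebroid I FA A where
  bracket := hA.bracket
  bracket_self := hA.bracket_self
  jacobi X Y Z := hA.onSections_injective <| by
    simp only [hA.onSections_bracket, ιA.onSections_add, C.leibniz (ιA.onSections X)]
  anchor :=
    { toFun x :=
        { toFun a := cdoSymbol (C.anchor.toFun x (ιA.toFun x a))
          map_add' a b := by simp [cdoSymbol]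
          map_smul' c a := by simp [cdoSymbol] }
      smooth' X := C.anchor.smooth_symbol (ιA.onSections X) }
  leibniz X Y f x := DFunLike.congr_fun (hA.bracket_fun_smul X Y f) x
  anchor_bracket X Y f x := by
    have h := C.symbolAct_bracket (ιA.onSections X) (ιA.onSections Y) f x
    rw [← hA.onSections_bracket] at h
    exact h

/-- The restriction of the anchor of `K` to a Dirac structure, as a representation on `E`. -/
def representation (hA : C.IsDirac ιA) : hA.lieAlgebroid.Representation FE E where
  toCDOMap := C.anchor.comp ιA
  symbol_eq _ _ := rfl
  act_bracket X Y u := by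
    simp only [CDOMap.comp_act]
    rw [← C.anchor_bracket, ← hA.onSections_bracket]
    rfl

theorem representation_act (hA : C.IsDirac ιA) (X : Cₛ^∞⟮I; FA, A⟯) (u : Cₛ^∞⟮I; FE, E⟯) :
    hA.representation.act X u = C.anchor.act (ιA.onSections X) u := rfl

theorem onSections_lieAlgebroid_bracket (hA : C.IsDirac ιA) (X Y : Cₛ^∞⟮I; FA, A⟯) :
    ιA.onSections (hA.lieAlgebroid.bracket X Y) =
      C.bracket (ιA.onSections X) (ιA.onSections Y) := hA.onSections_bracket X Y

/-- An element of `A` orthogonal to `B` lies in `B^⊥ = B`, which meets `A` in zero. -/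
theorem eq_zero_of_pairing_eq_zero (hA : C.IsDirac ιA) (hB : C.IsDirac ιB)
    (hAB : ∀ x, IsCompl (LinearMap.range (ιA.toFun x)) (LinearMap.range (ιB.toFun x)))
    (x : M) (a : A x) (h : ∀ b, C.pairing.toFun x (ιA.toFun x a) (ιB.toFun x b) = 0) : a = 0 := by
  have hmem : ιA.toFun x a ∈ LinearMap.range (ιB.toFun x) :=
    (hB.eq_orthogonal x _).2 (by rintro _ ⟨b, rfl⟩; exact h b)
  have h0 := Submodule.disjoint_def.1 (hAB x).disjoint _ ⟨a, rfl⟩ hmem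
  exact hA.injective x (by rw [h0, map_zero])

/-- The `E`-dual pair formed by two complementary Dirac structures, with `⟨a, b⟩ = 2 (a, b)`. -/
def dualBundles (hA : C.IsDirac ιA) (hB : C.IsDirac ιB)
    (hAB : ∀ x, IsCompl (LinearMap.range (ιA.toFun x)) (LinearMap.range (ιB.toFun x))) :
    EDualBundles I FE E FA A FB B where
  toFun x := (2 : ℝ) • (C.pairing.toFun x).compl₁₂ (ιA.toFun x) (ιB.toFun x)
  smooth' X Y :=
    ((2 : ℝ) • C.pairing.onSections (ιA.onSections X) (ιB.onSections Y)).contMDiff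
  nondegenerate_left x a h := hA.eq_zero_of_pairing_eq_zero hB hAB x a fun b =>
    (smul_eq_zero_iff_right (two_ne_zero (α := ℝ))).1 (h b)
  nondegenerate_right x b h := hB.eq_zero_of_pairing_eq_zero hA (fun x => (hAB x).symm) x b fun a =>
    (smul_eq_zero_iff_right (two_ne_zero (α := ℝ))).1 (by rw [C.pairing_symm]; exact h a)

theorem dualBundles_toFun (hA : C.IsDirac ιA) (hB : C.IsDirac ιB)
    (hAB : ∀ x, IsCompl (LinearMap.range (ιA.toFun x)) (LinearMap.range (ιB.toFun x)))
    (x : M) (a : A x) (b : B x) : (hA.dualBundles hB hAB).toFun x a b =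
      (2 : ℝ) • C.pairing.toFun x (ιA.toFun x a) (ιB.toFun x b) := rfl

/-! ### Splitting sections of `K` and identifying their components -/

variable {P : EDualBundles I FE E FA A FB B}

/-- The fibrewise components are smooth: by isotropy, pairing one of them with the opposite Dirac
structure gives the same as pairing `Z` with it. -/
theorem exists_decomposition (hA : C.IsDirac ιA) (hB : C.IsDirac ιB)
    (hAB : ∀ x, IsCompl (LinearMap.range (ιA.toFun x)) (LinearMap.range (ιB.toFun x)))
    (Z : Cₛ^∞⟮I; FK, K⟯) :
    ∃ X ξ, Z = ιA.onSections X + ιB.onSections ξ := by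
  have h : ∀ x, ∃ a b, ιA.toFun x a + ιB.toFun x b = Z x := fun x => by
    obtain ⟨_, ⟨a, rfl⟩, _, ⟨b, rfl⟩, h⟩ :=
      Submodule.mem_sup.1 ((hAB x).sup_eq_top ▸ Submodule.mem_top (x := Z x))
    exact ⟨a, b, h⟩
  choose a b hab using h
  let P := hA.dualBundles hB hAB
  have ha : CMDiff ∞ (T% a) := P.contMDiff_of_forall P.nondegenerate_left fun Y => by
    have : ∀ x, P.toFun x (a x) (Y x) =
        ((2 : ℝ) • C.pairing.onSections Z (ιB.onSections Y)) x := fun x => by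
      simp [P, dualBundles_toFun, ← hab, hB.toFun_eq_zero]
    simp only [this]
    exact ContMDiffSection.contMDiff _
  have hb : CMDiff ∞ (T% b) := P.flip.contMDiff_of_forall P.nondegenerate_right fun Y => by
    have : ∀ x, P.flip.toFun x (b x) (Y x) =
        ((2 : ℝ) • C.pairing.onSections (ιA.onSections Y) Z) x := fun x => by
      simp [P, EDualBundles.flip, SmoothPairing.flip, dualBundles_toFun, ← hab,
        hA.toFun_eq_zero]
    simp only [this]
    exact ContMDiffSection.contMDiff _
  refine ⟨⟨a, ha⟩, ⟨b, hb⟩, ?_⟩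
  ext x
  exact (hab x).symm

theorem onSections_eq (hP : ∀ x a b, P.toFun x a b =
      (2 : ℝ) • C.pairing.toFun x (ιA.toFun x a) (ιB.toFun x b))
    (X : Cₛ^∞⟮I; FA, A⟯) (ξ : Cₛ^∞⟮I; FB, B⟯) : P.onSections X ξ =
      (2 : ℝ) • C.pairing.onSections (ιA.onSections X) (ιB.onSections ξ) := by
  ext x
  exact hP x _ _

theorem isInvariant (hA : C.IsDirac ιA) (hB : C.IsDirac ιB)
    (hAB : ∀ x, IsCompl (LinearMap.range (ιA.toFun x)) (LinearMap.range (ιB.toFun x)))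
    (hP : ∀ x a b, P.toFun x a b =
      (2 : ℝ) • C.pairing.toFun x (ιA.toFun x a) (ιB.toFun x b)) :
    hA.representation.IsInvariant P := by
  have key : ∀ Z : Cₛ^∞⟮I; FK, K⟯, ∃ ξ, ∀ Y,
      (2 : ℝ) • C.pairing.onSections (ιA.onSections Y) Z = P.onSections Y ξ := fun Z => by
    obtain ⟨X, ξ, rfl⟩ := hA.exists_decomposition hB hAB Z
    refine ⟨ξ, fun Y => ?_⟩
    rw [onSections_eq hP, C.pairing.onSections_add_right, hA.pairing_eq_zero, zero_add]
  refine LieAlgebroid.Representation.isInvariant_of_exists (fun u => ?_) (fun X ξ => ?_)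
  · obtain ⟨ξ, hξ⟩ := key (C.diff u)
    refine ⟨ξ, fun Y => ?_⟩
    rw [← hξ, C.pairing_comm, C.pairing_diff, representation_act]
    module
  · obtain ⟨ζ, hζ⟩ := key (C.bracket (ιA.onSections X) (ιB.onSections ξ))
    refine ⟨ζ, fun Y => ?_⟩
    have h := C.anchor_pairing (ιA.onSections X) (ιA.onSections Y) (ιB.onSections ξ)
    rw [← hζ, onSections_eq hP, onSections_eq hP, representation_act,
      onSections_lieAlgebroid_bracket, CDOMap.act_smul]
    linear_combination (norm := module) (2 : ℝ) • h

/-- The component in `B` of a section of `K` is determined by its pairing with `Γ(A)`. -/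
theorem exists_eq_add (hA : C.IsDirac ιA) (hB : C.IsDirac ιB)
    (hAB : ∀ x, IsCompl (LinearMap.range (ιA.toFun x)) (LinearMap.range (ιB.toFun x)))
    {Z : Cₛ^∞⟮I; FK, K⟯} {ξ : Cₛ^∞⟮I; FB, B⟯}
    (h : ∀ Y, C.pairing.onSections (ιA.onSections Y) (ιB.onSections ξ) =
      C.pairing.onSections (ιA.onSections Y) Z) :
    ∃ X, Z = ιA.onSections X + ιB.onSections ξ := by
  obtain ⟨X, η, rfl⟩ := hA.exists_decomposition hB hAB Z
  refine ⟨X, ?_⟩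
  congr 2
  ext x
  rw [← sub_eq_zero]
  refine hB.eq_zero_of_pairing_eq_zero hA (fun x => (hAB x).symm) x _ fun a => ?_
  obtain ⟨Y, rfl⟩ := exists_smoothSection_apply_eq (I := I) (F := FA) x a
  have hx := DFunLike.congr_fun (h Y) x
  rw [C.pairing.onSections_add_right, hA.pairing_eq_zero, zero_add] at hx
  simp only [SmoothPairing.onSections_apply, SmoothBundleMap.onSections_apply] at hx
  rw [C.pairing_symm, map_sub, map_sub, hx, sub_self]

theorem exists_diff_eq_add (hA : C.IsDirac ιA) (hB : C.IsDirac ιB)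
    (hAB : ∀ x, IsCompl (LinearMap.range (ιA.toFun x)) (LinearMap.range (ιB.toFun x)))
    (hP : ∀ x a b, P.toFun x a b =
      (2 : ℝ) • C.pairing.toFun x (ιA.toFun x a) (ιB.toFun x b))
    (hinv : hA.representation.IsInvariant P) (u : Cₛ^∞⟮I; FE, E⟯) :
    ∃ X, C.diff u = ιA.onSections X + ιB.onSections (hinv.d u) := by
  refine hA.exists_eq_add hB hAB fun Y => ?_
  have h := hinv.onSections_d u Y
  rw [onSections_eq hP, representation_act] at h
  rw [C.pairing_comm _ (C.diff u), C.pairing_diff]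
  linear_combination (norm := module) (1 / 2 : ℝ) • h

theorem exists_bracket_eq_add (hA : C.IsDirac ιA) (hB : C.IsDirac ιB)
    (hAB : ∀ x, IsCompl (LinearMap.range (ιA.toFun x)) (LinearMap.range (ιB.toFun x)))
    (hP : ∀ x a b, P.toFun x a b =
      (2 : ℝ) • C.pairing.toFun x (ιA.toFun x a) (ιB.toFun x b))
    (hinv : hA.representation.IsInvariant P) (X : Cₛ^∞⟮I; FA, A⟯) (ξ : Cₛ^∞⟮I; FB, B⟯) :
    ∃ Y, C.bracket (ιA.onSections X) (ιB.onSections ξ) =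
      ιA.onSections Y + ιB.onSections (hinv.lieDeriv X ξ) := by
  refine hA.exists_eq_add hB hAB fun Y => ?_
  have h := hinv.onSections_lieDeriv X ξ Y
  have h' := C.anchor_pairing (ιA.onSections X) (ιA.onSections Y) (ιB.onSections ξ)
  rw [onSections_eq hP, onSections_eq hP, onSections_eq hP, representation_act,
    onSections_lieAlgebroid_bracket, CDOMap.act_smul] at h
  linear_combination (norm := module) (1 / 2 : ℝ) • h + h'

/-- The `E`-dual pair of Lie algebroids formed by two complementary Dirac structures. -/
def dualPair (hA : C.IsDirac ιA) (hB : C.IsDirac ιB)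
    (hAB : ∀ x, IsCompl (LinearMap.range (ιA.toFun x)) (LinearMap.range (ιB.toFun x))) :
    EDualPair I FE E FA A FB B where
  dual := hA.dualBundles hB hAB
  lieA := hA.lieAlgebroid
  lieB := hB.lieAlgebroid
  repA := hA.representation
  repB := hB.representation
  invA := hA.isInvariant hB hAB fun _ _ _ => rfl
  invB := hB.isInvariant hA (fun x => (hAB x).symm) fun x _ _ =>
    congrArg _ (C.pairing_symm x _ _)

/-- (EC-3) absorbs the term in `[ξ 0, ξ 1]`; exchanging `ξ 0` and `X` in the remaining bracket costs
`ρ(ξ 1)(ξ 0, X)_E`, which cancels the second derivative term. -/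
theorem dB_eq (hA : C.IsDirac ιA) (hB : C.IsDirac ιB)
    (hAB : ∀ x, IsCompl (LinearMap.range (ιA.toFun x)) (LinearMap.range (ιB.toFun x)))
    (X : Cₛ^∞⟮I; FA, A⟯) (ξ : Fin 2 → Cₛ^∞⟮I; FB, B⟯) :
    (hA.dualPair hB hAB).dB X ξ = (-2 : ℝ) • C.pairing.onSections
      (C.bracket (ιA.onSections X) (ιB.onSections (ξ 0))) (ιB.onSections (ξ 1)) := by
  have hP : ∀ η : Cₛ^∞⟮I; FB, B⟯, (hA.dualPair hB hAB).dual.flip.onSections η X =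
      (2 : ℝ) • C.pairing.onSections (ιB.onSections η) (ιA.onSections X) := fun η =>
    onSections_eq (fun x _ _ => congrArg _ (C.pairing_symm x _ _)) η X
  have h := C.anchor_pairing (ιB.onSections (ξ 0)) (ιB.onSections (ξ 1)) (ιA.onSections X)
  have hs := congrArg (fun Z => C.pairing.onSections (ιB.onSections (ξ 1)) Z)
    (C.bracket_add_bracket_swap (ιB.onSections (ξ 0)) (ιA.onSections X))
  simp only [C.pairing.onSections_add_right, C.pairing.onSections_smul_right] at hs
  rw [C.pairing_comm _ (C.diff _), C.pairing_diff] at hs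
  rw [EDualPair.dB, LieAlgebroid.Representation.coboundary_toForm, hP, hP, hP]
  show hB.representation.act _ _ - hB.representation.act _ _ -
    (2 : ℝ) • C.pairing.onSections (ιB.onSections (hB.lieAlgebroid.bracket _ _)) _ = _
  rw [representation_act, representation_act, onSections_lieAlgebroid_bracket, CDOMap.act_smul,
    CDOMap.act_smul, C.pairing_comm (C.bracket (ιA.onSections X) _)]
  linear_combination (norm := module) (2 : ℝ) • h + (2 : ℝ) • hs

theorem eq_of_add_eq_add (hA : C.IsDirac ιA)
    (hAB : ∀ x, IsCompl (LinearMap.range (ιA.toFun x)) (LinearMap.range (ιB.toFun x)))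
    {X Y : Cₛ^∞⟮I; FA, A⟯} {ξ η : Cₛ^∞⟮I; FB, B⟯}
    (h : ιA.onSections X + ιB.onSections ξ = ιA.onSections Y + ιB.onSections η) : X = Y := by
  ext x
  refine hA.injective x ?_
  rw [← sub_eq_zero]
  have hx : ιA.toFun x (X x) + ιB.toFun x (ξ x) = ιA.toFun x (Y x) + ιB.toFun x (η x) :=
    DFunLike.congr_fun h x
  refine Submodule.disjoint_def.1 (hAB x).disjoint _ ⟨X x - Y x, map_sub _ _ _⟩
    ⟨η x - ξ x, ?_⟩
  rw [map_sub]
  linear_combination (norm := module) -hx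

theorem isELieBialgebroid (hA : C.IsDirac ιA) (hB : C.IsDirac ιB)
    (hAB : ∀ x, IsCompl (LinearMap.range (ιA.toFun x)) (LinearMap.range (ιB.toFun x))) :
    (hA.dualPair hB hAB).IsELieBialgebroid := by
  have hBA : ∀ x, IsCompl (LinearMap.range (ιB.toFun x)) (LinearMap.range (ιA.toFun x)) :=
    fun x => (hAB x).symm
  have hP : ∀ x a b, (hA.dualPair hB hAB).dual.toFun x a b =
      (2 : ℝ) • C.pairing.toFun x (ιA.toFun x a) (ιB.toFun x b) := fun _ _ _ => rfl
  have hP' : ∀ x b a, (hA.dualPair hB hAB).dual.flip.toFun x b a =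
      (2 : ℝ) • C.pairing.toFun x (ιB.toFun x b) (ιA.toFun x a) :=
    fun x _ _ => congrArg _ (C.pairing_symm x _ _)
  have hdiff : ∀ u, C.diff u = ιA.onSections ((hA.dualPair hB hAB).invB.d u) +
      ιB.onSections ((hA.dualPair hB hAB).invA.d u) := fun u => by
    obtain ⟨X, hX⟩ := hA.exists_diff_eq_add hB hAB hP (hA.dualPair hB hAB).invA u
    obtain ⟨ξ, hξ⟩ := hB.exists_diff_eq_add hA hBA hP' (hA.dualPair hB hAB).invB u
    -- One splitting of `Du` identifies its `B`-component, the other its `A`-component; uniqueness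
    -- merges them.
    have hXd := hA.eq_of_add_eq_add hAB (hX.symm.trans (hξ.trans (add_comm _ _)))
    rw [hX, hXd]
    rfl
  refine ⟨fun X Y ξ => ?_, fun u X => ?_, fun u => ?_⟩
  · have hbr : (hA.dualPair hB hAB).lieA.bracket = hA.lieAlgebroid.bracket := rfl
    have hact : ∀ X u, (hA.dualPair hB hAB).repA.act X u =
      C.anchor.act (ιA.onSections X) u := fun _ _ => rfl
    simp only [LieAlgebroid.Representation.IsInvariant.lieDeriv₂, dB_eq, hbr,
      onSections_lieAlgebroid_bracket, hact, CDOMap.act_smul, C.anchor_pairing,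
      Matrix.cons_val_zero, Matrix.cons_val_one]
    have hdec : ∀ X ζ, ∃ Y, C.bracket (ιA.onSections X) (ιB.onSections ζ) =
        ιA.onSections Y + ιB.onSections ((hA.dualPair hB hAB).invA.lieDeriv X ζ) :=
      hA.exists_bracket_eq_add hB hAB hP (hA.dualPair hB hAB).invA
    obtain ⟨aX, haX⟩ := hdec X (ξ 0)
    obtain ⟨aY, haY⟩ := hdec Y (ξ 0)
    obtain ⟨cX, hcX⟩ := hdec X (ξ 1)
    obtain ⟨cY, hcY⟩ := hdec Y (ξ 1)
    have e₁ := congrArg (fun Z => C.pairing.onSections Z (ιB.onSections (ξ 1)))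
      (C.leibniz (ιA.onSections X) (ιA.onSections Y) (ιB.onSections (ξ 0)))
    -- `[X, ·]` is skew on `Γ(B)` for the pairing, because `(ζ, ξ 1)_E = 0`.
    have e₂ : ∀ (X : Cₛ^∞⟮I; FA, A⟯) (ζ : Cₛ^∞⟮I; FB, B⟯),
        C.pairing.onSections (C.bracket (ιA.onSections X) (ιB.onSections ζ))
          (ιB.onSections (ξ 1)) +
        C.pairing.onSections (ιB.onSections ζ)
          (C.bracket (ιA.onSections X) (ιB.onSections (ξ 1))) = 0 := fun X ζ => by
      rw [← C.anchor_pairing, hB.pairing_eq_zero]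
      ext x
      simp [cdoApply]
    have e₃ := e₂ Y ((hA.dualPair hB hAB).invA.lieDeriv X (ξ 0))
    have e₄ := e₂ X ((hA.dualPair hB hAB).invA.lieDeriv Y (ξ 0))
    have e₅ := congrArg₂ C.pairing.onSections haY hcX
    have e₆ := congrArg₂ C.pairing.onSections haX hcY
    have e₇ := congrArg (fun Z => C.pairing.onSections Z
      (ιB.onSections ((hA.dualPair hB hAB).invA.lieDeriv X (ξ 1)))) haY
    have e₈ := congrArg (fun Z => C.pairing.onSections Z
      (ιB.onSections ((hA.dualPair hB hAB).invA.lieDeriv Y (ξ 1)))) haX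
    rw [hcY] at e₃
    rw [hcX] at e₄
    simp only [C.pairing.onSections_add_left, C.pairing.onSections_add_right,
      hA.pairing_eq_zero, hB.pairing_eq_zero] at e₁ e₃ e₄ e₅ e₆ e₇ e₈
    -- With `[Y, ξ 0] = aY + 𝔏_Y ξ 0` and `[X, ξ 1] = cX + 𝔏_X ξ 1`, isotropy leaves `(aY, 𝔏_X ξ 1)
    -- + (𝔏_Y ξ 0, cX)` of their pairing. The first term is matched by `e₇`, the second by `e₄`;
    -- likewise with `X` and `Y` exchanged.
    linear_combination (norm := module) (2 : ℝ) • e₁ - (2 : ℝ) • e₃ + (2 : ℝ) • e₄ +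
      (2 : ℝ) • e₅ - (2 : ℝ) • e₆ - (2 : ℝ) • e₇ + (2 : ℝ) • e₈
  · obtain ⟨ξ, hξ⟩ := hB.exists_bracket_eq_add hA hBA hP' (hA.dualPair hB hAB).invB
      ((hA.dualPair hB hAB).invA.d u) X
    have h := C.bracket_diff_left u (ιA.onSections X)
    rw [hdiff, map_add, LinearMap.add_apply, hξ, ← hA.onSections_lieAlgebroid_bracket, ← add_assoc,
      add_right_comm, ← ιA.onSections_add] at h
    -- The `A`-component of `0 = [d^B u, X] + [d^A u, X]`, whose second bracket contributes `𝔏_{d^A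
    -- u} X`.
    have h0 := hA.eq_of_add_eq_add hAB (Y := 0) (η := 0)
      (h.trans (by rw [ιA.onSections_zero, ιB.onSections_zero, add_zero]))
    exact eq_neg_of_add_eq_zero_right h0
  · have h := C.act_diff u u
    have h2 := C.pairing_diff u (C.diff u)
    -- Here `h2` reads `(Du, Du)_E = 0`, and isotropy leaves only twice the cross term, which is
    -- `⟨d^B u, d^A u⟩_E`.
    rw [h, hdiff u] at h2
    simp only [C.pairing.onSections_add_left, C.pairing.onSections_add_right,
      hA.pairing_eq_zero, hB.pairing_eq_zero] at h2
    rw [C.pairing_comm (ιB.onSections _)] at h2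
    rw [onSections_eq hP]
    linear_combination (norm := module) h2

end IsDirac

end ECourantAlgebroid

end

theorem mainTheorem8
    -- the smooth manifold `M` (finite-dimensional, without boundary)
    {EM : Type*} [NormedAddCommGroup EM] [NormedSpace ℝ EM] [FiniteDimensional ℝ EM]
    {HM : Type*} [TopologicalSpace HM] {I : ModelWithCorners ℝ EM HM}
    {M : Type*} [TopologicalSpace M] [ChartedSpace HM M] [IsManifold I ∞ M]
    [BoundarylessManifold I M] [T2Space M] [SigmaCompactSpace M]
    -- the smooth vector bundles `E`, `K`, `A`, `B` over `M`
    {FE : Type*} [NormedAddCommGroup FE] [NormedSpace ℝ FE] [FiniteDimensional ℝ FE]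
    {E : M → Type*} [TopologicalSpace (TotalSpace FE E)]
    [∀ x, AddCommGroup (E x)] [∀ x, Module ℝ (E x)] [∀ x, TopologicalSpace (E x)]
    [FiberBundle FE E] [VectorBundle ℝ FE E] [ContMDiffVectorBundle ∞ FE E I]
    {FK : Type*} [NormedAddCommGroup FK] [NormedSpace ℝ FK] [FiniteDimensional ℝ FK]
    {K : M → Type*} [TopologicalSpace (TotalSpace FK K)]
    [∀ x, AddCommGroup (K x)] [∀ x, Module ℝ (K x)] [∀ x, TopologicalSpace (K x)]
    [FiberBundle FK K] [VectorBundle ℝ FK K] [ContMDiffVectorBundle ∞ FK K I]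
    {FA : Type*} [NormedAddCommGroup FA] [NormedSpace ℝ FA] [FiniteDimensional ℝ FA]
    {A : M → Type*} [TopologicalSpace (TotalSpace FA A)]
    [∀ x, AddCommGroup (A x)] [∀ x, Module ℝ (A x)] [∀ x, TopologicalSpace (A x)]
    [FiberBundle FA A] [VectorBundle ℝ FA A] [ContMDiffVectorBundle ∞ FA A I]
    {FB : Type*} [NormedAddCommGroup FB] [NormedSpace ℝ FB] [FiniteDimensional ℝ FB]
    {B : M → Type*} [TopologicalSpace (TotalSpace FB B)]
    [∀ x, AddCommGroup (B x)] [∀ x, Module ℝ (B x)] [∀ x, TopologicalSpace (B x)]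
    [FiberBundle FB B] [VectorBundle ℝ FB B] [ContMDiffVectorBundle ∞ FB B I]
    -- an `E`-Courant algebroid `K` and Dirac structures `A`, `B` in it with `K = A ⊕ B`
    (C : ECourantAlgebroid I FE E FK K)
    (ιA : SmoothBundleMap I FK K FA A) (ιB : SmoothBundleMap I FK K FB B)
    (hA : C.IsDirac ιA) (hB : C.IsDirac ιB)
    (hAB : ∀ x, IsCompl (LinearMap.range (ιA.toFun x)) (LinearMap.range (ιB.toFun x))) :
    ∃ D : EDualPair I FE E FA A FB B,
      -- `⟨a, b⟩_E = 2 (a, b)_E`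
      (∀ x a b, D.dual.toFun x a b = (2 : ℝ) • C.pairing.toFun x (ιA.toFun x a) (ιB.toFun x b)) ∧
      -- the brackets of `A` and `B` are the restrictions of the bracket of `K`
      (∀ X Y, ιA.onSections (D.lieA.bracket X Y) =
        C.bracket (ιA.onSections X) (ιA.onSections Y)) ∧
      (∀ X Y, ιB.onSections (D.lieB.bracket X Y) =
        C.bracket (ιB.onSections X) (ιB.onSections Y)) ∧
      -- the representations are the restrictions of the anchor of `K`
      (∀ x a, D.repA.toFun x a = C.anchor.toFun x (ιA.toFun x a)) ∧
      (∀ x b, D.repB.toFun x b = C.anchor.toFun x (ιB.toFun x b)) ∧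
      D.IsELieBialgebroid :=
  ⟨hA.dualPair hB hAB, fun _ _ _ => rfl, hA.onSections_bracket, hB.onSections_bracket,
    fun _ _ => rfl, fun _ _ => rfl, hA.isELieBialgebroid hB hAB⟩
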